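/- Let $\sigma\ge 0$, $\delta>0$ and $g=(g_n)_{n\in\mathbb Z}\in\ell^2$, where $\ell^2=\ell^2(\mathbb Z;\mathbb C)$. Consider the damped and driven discrete nonlinear Schrödinger equation on the infinite lattice $$ i\dot u_n+(u_{n-1}-2u_n+u_{n+1})+i\delta u_n+|u_n|^{2\sigma}u_n=g_n,\qquad n\in\mathbb Z,\ t\ge 0, \tag{1}$$ with initial data in $\ell^2$, and for each integer $m\ge 0$ its truncation to $|n|\le m$ with Dirichlet boundary conditions, in $\mathbb C^{2m+1}$ with the Euclidean norm, $$ i\dot \psi_n+(\psi_{n-1}-2\psi_n+\psi_{n+1})+i\delta \psi_n+|\psi_n|^{2\sigma}\psi_n=g_n,\quad |n|\le m,\qquad \psi_{-(m+1)}=\psi_{m+1}=0. \tag{2}$$ For every initial state in $\ell^2$ (respectively in $\mathbb C^{2m+1}$), (1) (respectively (2)) has a unique solution in $C^1([0,\infty),\ell^2)$ (respectively $C^1([0,\infty),\mathbb C^{2m+1})$). Let $S(t)$ and $S_m(t)$, $t\ge 0$, be the solution semigroups so defined. A global attractor of a semigroup is a nonempty compact set that is strictly invariant ($S(t)\mathcal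 A=\mathcal A$ for all $t\ge0$) and that attracts every bounded set $\mathcal B$, i.e. $d(S(t)\mathcal B,\mathcal A)\to 0$ as $t\to\infty$, where $d(\mathcal B_1,\mathcal B_2)=\sup_{x\in \mathcal B_1}\inf_{y\in \mathcal B_2}\|x-y\|$ is the Hausdorff semidistance. Then $S(t)$ has a unique global attractor $\mathcal A\subset\ell^2$, each $S_m(t)$ has a unique global attractor $\mathcal A_m\subset\mathbb C^{2m+1}$, and, if $\mathbb C^{2m+1}$ is regarded as a subset of $\ell^2$ through extension by zero, $$\lim_{m\to\infty} d(\mathcal A_m,\mathcal A)=0$$ with respect to the norm of $\ell^2$. -/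

import Mathlib

open Filter Topology
open scoped NNReal ENNReal

noncomputable section

namespace DNLS

/-- The space `ℓ²` of square-summable complex sequences indexed by `ℤ`, with its norm. -/
abbrev Ell2 : Type := lp (fun _ : ℤ => ℂ) 2

/-- The space `ℂ^{2m+1}` of vectors indexed by the sites `|n| ≤ m`, with the Euclidean norm. -/
abbrev Trunc (m : ℕ) : Type := EuclideanSpace ℂ (Finset.Icc (-(m : ℤ)) (m : ℤ))

/-- Extension by zero of a vector on the sites `|n| ≤ m` to all of `ℤ`. -/
def zeroExtend (m : ℕ) (ψ : Trunc m) (n : ℤ) : ℂ :=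
  if h : n ∈ Finset.Icc (-(m : ℤ)) (m : ℤ) then ψ ⟨n, h⟩ else 0

theorem memℓp_zeroExtend (m : ℕ) (ψ : Trunc m) : Memℓp (zeroExtend m ψ) 2 := by
  refine (memℓp_zero ?_).of_exponent_ge zero_le
  refine (Finset.Icc (-(m : ℤ)) (m : ℤ)).finite_toSet.subset ?_
  intro n hn
  by_contra h
  exact hn (dif_neg h)

/-- Extension by zero, as a map from `ℂ^{2m+1}` to `ℓ²`. -/
def toEll2 (m : ℕ) (ψ : Trunc m) : Ell2 := ⟨zeroExtend m ψ, memℓp_zeroExtend m ψ⟩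

/-- The `n`-th equation of the damped, driven discrete nonlinear Schrödinger system
`i v_n + (w_{n-1} - 2 w_n + w_{n+1}) + i δ w_n + |w_n|^{2σ} w_n = g_n`,
where `w` is the state and `v` is the value at the site `n` of its time derivative. -/
def Equation (σ δ : ℝ) (g : ℤ → ℂ) (w : ℤ → ℂ) (v : ℂ) (n : ℤ) : Prop :=
  Complex.I * v + (w (n - 1) - 2 * w n + w (n + 1)) + Complex.I * (δ : ℂ) * w n
    + ((‖w n‖ ^ (2 * σ) : ℝ) : ℂ) * w n = g n

/-- `u ∈ C¹([0,∞), ℓ²)` solves the system on the infinite lattice.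
(Values of `u` at negative times play no role.) -/
def IsLatticeSolution (σ δ : ℝ) (g : Ell2) (u : ℝ → Ell2) : Prop :=
  ∃ v : ℝ → Ell2, ContinuousOn v (Set.Ici 0) ∧
    ∀ t : ℝ, 0 ≤ t → HasDerivWithinAt u (v t) (Set.Ici 0) t ∧
      ∀ n : ℤ, Equation σ δ g (u t) (v t n) n

/-- `ψ ∈ C¹([0,∞), ℂ^{2m+1})` solves the system truncated to the sites `|n| ≤ m`, with Dirichlet
boundary conditions `ψ_{-(m+1)} = ψ_{m+1} = 0`. -/
def IsTruncatedSolution (σ δ : ℝ) (g : Ell2) (m : ℕ) (ψ : ℝ → Trunc m) : Prop :=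
  ∃ v : ℝ → Trunc m, ContinuousOn v (Set.Ici 0) ∧
    ∀ t : ℝ, 0 ≤ t → HasDerivWithinAt ψ (v t) (Set.Ici 0) t ∧
      ∀ n : Finset.Icc (-(m : ℤ)) (m : ℤ),
        Equation σ δ g (zeroExtend m (ψ t)) (v t n) n

/-- `S` is the solution semigroup of the evolution problem whose solutions on `[0,∞)` are singled
out by `IsSol`: for every initial state `x`, the map `t ↦ S t x` is a solution starting at `x`,
and it is the only one. -/
structure IsSolutionSemigroup {X : Type*} (IsSol : (ℝ → X) → Prop) (S : ℝ≥0 → X → X) : Prop where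
  initial : ∀ x, S 0 x = x
  solves : ∀ x, IsSol (fun t => S t.toNNReal x)
  unique : ∀ u, IsSol u → ∀ t : ℝ≥0, u t = S t (u 0)

/-- The Hausdorff semidistance `sup_{x ∈ B₁} inf_{y ∈ B₂} d(x, y)`, as an extended nonnegative
real number (it is finite when both sets are nonempty and bounded). -/
def semidist {X : Type*} [PseudoEMetricSpace X] (B₁ B₂ : Set X) : ℝ≥0∞ :=
  ⨆ x ∈ B₁, ⨅ y ∈ B₂, edist x y

/-- `A` is the global attractor of `S`: a nonempty compact set, strictly invariant, that attracts
every bounded set. -/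
structure IsGlobalAttractor {X : Type*} [PseudoMetricSpace X] (S : ℝ≥0 → X → X) (A : Set X) :
    Prop where
  nonempty : A.Nonempty
  isCompact : IsCompact A
  invariant : ∀ t, S t '' A = A
  attracts : ∀ B : Set X, Bornology.IsBounded B →
    Tendsto (fun t => semidist (S t '' B) A) atTop (𝓝 0)

end DNLS

end

/-!
Both systems have the form `u' = f u` in a complex Hilbert space, where `f` is Lipschitz on balls
and `2 Re ⟪u, f u⟫ ≤ -δ ‖u‖² + ‖g‖² / δ` (`IsDissipative`): the discrete Laplacian and the nonlinearity
enter multiplied by `i` and do not contribute to the energy. Such an equation generates a continuous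
semigroup with an absorbing ball (`IsDissipative.exists_isSolutionSemigroup`,
`IsDissipative.exists_absorbing`), and the radius of this ball is the same for the lattice and for
all truncations.

A continuous semigroup with an absorbing set whose images come close to compact sets has a global
attractor, the `ω`-limit set of the absorbing set (`isGlobalAttractor_omegaLimitSet`). In finite
dimension the absorbing ball is itself compact. On the lattice, compactness comes from a tail
estimate: for a weight `θ` with values in `[0, 1]`, the energy balance of `∑ θ n |u n|²` is the same
up to a commutator with the Laplacian, which is at most `2 L ‖u‖²` if `θ` varies by at most `L`
between neighbours (`re_inner_weightMul_latticeField_le`). With weights that vanish near the origin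
and vary slowly, this shows that the energy at far sites becomes small (`tailEnergy_le`). The
truncated field is the restriction of the lattice field to `|n| ≤ m`, and restriction is the adjoint
of extension by zero, so that the same estimate, with the same constants, holds for the truncations.

For the upper semicontinuity, a point of `A_m` is `S_m(T) y` with `y` in `A_m`, where `T` is a time
after which the lattice flow has moved the absorbing ball close to `A`. The orbit of `y` stays in
`A_m`, whose tails are small uniformly in `m`; hence, extended by zero, it solves the lattice system
up to an error that tends to `0` as `m → ∞` (`norm_latticeField_sub_truncatedField_le`), and by
Grönwall's inequality `S_m(T) y` is close to `S(T) y`, which is close to `A`.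
-/

noncomputable section

namespace DNLS

/-! ### Radial retraction onto a ball -/

section Retraction

variable {E : Type*} [NormedAddCommGroup E] [NormedSpace ℝ E]

/-- The radial retraction of a normed space onto the closed ball of radius `R` about the origin. -/
def radialRetraction (R : ℝ) (x : E) : E := (R / max R ‖x‖) • x

theorem radialRetraction_eq_self {R : ℝ} (hR : 0 < R) {x : E} (hx : ‖x‖ ≤ R) :
    radialRetraction R x = x := by
  rw [radialRetraction, max_eq_left hx, div_self hR.ne', one_smul]

theorem norm_radialRetraction_le {R : ℝ} (hR : 0 < R) (x : E) : ‖radialRetraction R x‖ ≤ R := by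
  have hM : 0 < max R ‖x‖ := lt_max_of_lt_left hR
  rw [radialRetraction, norm_smul, Real.norm_of_nonneg (by positivity), div_mul_eq_mul_div,
    div_le_iff₀ hM]
  exact mul_le_mul_of_nonneg_left (le_max_right _ _) hR.le

theorem lipschitzWith_radialRetraction {R : ℝ} (hR : 0 < R) :
    LipschitzWith 2 (radialRetraction R : E → E) := by
  refine LipschitzWith.of_dist_le_mul fun x y => ?_
  have hx : 0 < max R ‖x‖ := lt_max_of_lt_left hR
  have hy : 0 < max R ‖y‖ := lt_max_of_lt_left hR
  have hmax : |max R ‖y‖ - max R ‖x‖| ≤ ‖x - y‖ := by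
    rw [max_comm R, max_comm R]
    refine (abs_max_sub_max_le_abs _ _ _).trans ?_
    rw [abs_sub_comm]
    exact abs_norm_sub_norm_le x y
  have hsplit : radialRetraction R x - radialRetraction R y
      = (R / max R ‖x‖) • (x - y) + (R / max R ‖x‖ - R / max R ‖y‖) • y := by
    simp only [radialRetraction, smul_sub, sub_smul]; abel
  have h1 : ‖(R / max R ‖x‖) • (x - y)‖ ≤ ‖x - y‖ := by
    rw [norm_smul, Real.norm_of_nonneg (by positivity)]
    exact mul_le_of_le_one_left (norm_nonneg _) ((div_le_one hx).2 (le_max_left _ _))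
  have h2 : ‖(R / max R ‖x‖ - R / max R ‖y‖) • y‖ ≤ ‖x - y‖ := by
    have hc : R / max R ‖x‖ - R / max R ‖y‖
        = (R / max R ‖x‖) * ((max R ‖y‖ - max R ‖x‖) / max R ‖y‖) := by
      field_simp
    rw [norm_smul, hc, norm_mul, Real.norm_of_nonneg (by positivity : 0 ≤ R / max R ‖x‖),
      norm_div, Real.norm_of_nonneg hy.le, Real.norm_eq_abs]
    calc R / max R ‖x‖ * (|max R ‖y‖ - max R ‖x‖| / max R ‖y‖) * ‖y‖
        = (R / max R ‖x‖) * (‖y‖ / max R ‖y‖) * |max R ‖y‖ - max R ‖x‖| := by ring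
      _ ≤ 1 * 1 * |max R ‖y‖ - max R ‖x‖| := by
        gcongr
        · exact (div_le_one hx).2 (le_max_left _ _)
        · exact (div_le_one hy).2 (le_max_right _ _)
      _ ≤ ‖x - y‖ := by simpa using hmax
  rw [dist_eq_norm, dist_eq_norm, hsplit]
  refine (norm_add_le _ _).trans ?_
  push_cast
  linarith

end Retraction

/-! ### Dissipative ordinary differential equations in a Hilbert space -/

section Solutions

variable {E : Type*} [NormedAddCommGroup E] [NormedSpace ℝ E] {f : E → E}

/-- `u` solves the autonomous equation `u' = f u` on `[0, T]`. -/
def SolvesOn (f : E → E) (T : ℝ) (u : ℝ → E) : Prop :=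
  ∀ t ∈ Set.Icc 0 T, HasDerivWithinAt u (f (u t)) (Set.Icc 0 T) t

/-- `u` solves the autonomous equation `u' = f u` on `[0, ∞)`. -/
def SolvesForward (f : E → E) (u : ℝ → E) : Prop :=
  ∀ t, 0 ≤ t → HasDerivWithinAt u (f (u t)) (Set.Ici 0) t

theorem SolvesForward.solvesOn {u : ℝ → E} (hu : SolvesForward f u) (T : ℝ) :
    SolvesOn f T u :=
  fun t ht => (hu t ht.1).mono Set.Icc_subset_Ici_self

theorem SolvesOn.mono {u : ℝ → E} {T T' : ℝ} (hu : SolvesOn f T u) (h : T' ≤ T) :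
    SolvesOn f T' u :=
  fun t ht => (hu t ⟨ht.1, ht.2.trans h⟩).mono (Set.Icc_subset_Icc_right h)

theorem SolvesOn.continuousOn {u : ℝ → E} {T : ℝ} (hu : SolvesOn f T u) :
    ContinuousOn u (Set.Icc 0 T) :=
  fun t ht => (hu t ht).continuousWithinAt

theorem hasDerivWithinAt_Ici_of_Icc {F : Type*} [NormedAddCommGroup F] [NormedSpace ℝ F]
    {u : ℝ → F} {v : F} {T t : ℝ} (h : HasDerivWithinAt u v (Set.Icc 0 T) t)
    (ht : t ∈ Set.Ico 0 T) : HasDerivWithinAt u v (Set.Ici t) t :=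
  h.mono_of_mem_nhdsWithin
    (mem_of_superset (Icc_mem_nhdsGE ht.2) (Set.Icc_subset_Icc_left ht.1))

theorem SolvesForward.shift {u : ℝ → E} (hu : SolvesForward f u) {s : ℝ} (hs : 0 ≤ s) :
    SolvesForward f (fun t => u (t + s)) := fun t ht => by
  have h := (hu (t + s) (by positivity)).scomp_of_eq t
    (((hasDerivAt_id t).add_const s).hasDerivWithinAt (s := Set.Ici 0))
    (fun r hr => by simpa using add_nonneg hr hs) rfl
  simpa [Function.comp_def] using! h

theorem IsSolutionSemigroup.add_apply {S : ℝ≥0 → E → E}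
    (hS : IsSolutionSemigroup (SolvesForward f) S) (s t : ℝ≥0)
    (x : E) : S (s + t) x = S s (S t x) := by
  have h := hS.unique _ ((hS.solves x).shift t.2) s
  have e : ((s : ℝ) + t).toNNReal = s + t := by
    rw [← NNReal.coe_add, Real.toNNReal_coe]
  simpa [e] using h

end Solutions

section Dissipative

variable {E : Type*} [NormedAddCommGroup E] [InnerProductSpace ℂ E]

/-- A vector field that is Lipschitz on every ball and points inwards on large spheres:
`2 Re ⟪x, f x⟫ ≤ -δ ‖x‖² + C`. -/
structure IsDissipative (f : E → E) (δ C : ℝ) : Prop where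
  lipschitz : ∀ R : ℝ, ∃ K : ℝ≥0, LipschitzOnWith K f (Metric.closedBall 0 R)
  inner_le : ∀ x, 2 * (inner ℂ x (f x)).re ≤ -δ * ‖x‖ ^ 2 + C

variable {f : E → E} {δ C : ℝ}

theorem IsDissipative.nonneg (hf : IsDissipative f δ C) : 0 ≤ C := by
  simpa using hf.inner_le 0

theorem IsDissipative.continuous (hf : IsDissipative f δ C) : Continuous f := by
  refine continuous_iff_continuousAt.2 fun x => ?_
  obtain ⟨K, hK⟩ := hf.lipschitz (‖x‖ + 1)
  refine hK.continuousOn.continuousAt (Metric.closedBall_mem_nhds_of_mem ?_)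
  simp

variable [NormedSpace ℝ E] [IsScalarTower ℝ ℂ E]

theorem hasDerivWithinAt_quadraticForm (Θ : E →L[ℂ] E)
    (hΘ : ∀ x y, inner ℂ (Θ x) y = inner ℂ x (Θ y)) {u : ℝ → E} {v : E} {s : Set ℝ} {t : ℝ}
    (h : HasDerivWithinAt u v s t) :
    HasDerivWithinAt (fun t => (inner ℂ (Θ (u t)) (u t)).re) (2 * (inner ℂ (Θ (u t)) v).re)
      s t := by
  have h1 : HasDerivWithinAt (fun t => Θ (u t)) (Θ v) s t :=
    ((Θ.restrictScalars ℝ).hasFDerivAt.comp_hasDerivWithinAt t h)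
  have h2 := h1.inner ℂ h
  have h3 := Complex.reCLM.hasFDerivAt.comp_hasDerivWithinAt t h2
  refine h3.congr_deriv ?_
  have hre : (inner ℂ v (Θ (u t))).re = (inner ℂ (Θ (u t)) v).re := inner_re_symm (𝕜 := ℂ) _ _
  rw [hΘ v, Complex.reCLM_apply, Complex.add_re, hre, two_mul]

/-- Grönwall's inequality for a quadratic form along a curve, with an exponentially decaying
contribution of the initial value. -/
theorem quadraticForm_le_of_inner_le (Θ : E →L[ℂ] E)
    (hΘ : ∀ x y, inner ℂ (Θ x) y = inner ℂ x (Θ y)) {u v : ℝ → E} {T : ℝ} (hδ : 0 < δ)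
    (hC : 0 ≤ C) (hT : 0 ≤ T) (hu : ∀ t ∈ Set.Icc 0 T, HasDerivWithinAt u (v t) (Set.Icc 0 T) t)
    (hv : ∀ t ∈ Set.Icc 0 T,
      2 * (inner ℂ (Θ (u t)) (v t)).re ≤ -δ * (inner ℂ (Θ (u t)) (u t)).re + C) :
    (inner ℂ (Θ (u T)) (u T)).re
      ≤ Real.exp (-δ * T) * (inner ℂ (Θ (u 0)) (u 0)).re + C / δ := by
  have hd := fun t ht => hasDerivWithinAt_quadraticForm Θ hΘ (hu t ht)
  have key := le_gronwallBound_of_liminf_deriv_right_le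
    (f := fun t => (inner ℂ (Θ (u t)) (u t)).re) (K := -δ) (ε := C)
    (fun t ht => (hd t ht).continuousWithinAt)
    (fun t ht r hr => (hasDerivWithinAt_Ici_of_Icc (hd t (Set.Ico_subset_Icc_self ht))
      ht).liminf_right_slope_le hr) le_rfl
    (fun t ht => hv t (Set.Ico_subset_Icc_self ht)) T ⟨hT, le_rfl⟩
  refine key.trans ?_
  rw [gronwallBound_of_K_ne_0 (neg_ne_zero.2 hδ.ne'), sub_zero]
  have h1 : C / -δ * (Real.exp (-δ * T) - 1) = C / δ - C / δ * Real.exp (-δ * T) := by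
    rw [div_neg]; ring
  have h2 : 0 ≤ C / δ * Real.exp (-δ * T) := by positivity
  simp only [h1]
  linarith

theorem IsDissipative.norm_sq_le (hf : IsDissipative f δ C) (hδ : 0 < δ) {T : ℝ} (hT : 0 ≤ T)
    {u : ℝ → E} (hu : SolvesOn f T u) :
    ‖u T‖ ^ 2 ≤ Real.exp (-δ * T) * ‖u 0‖ ^ 2 + C / δ := by
  have hsq : ∀ x : E, (inner ℂ x x).re = ‖x‖ ^ 2 := fun x => inner_self_eq_norm_sq (𝕜 := ℂ) x
  have := quadraticForm_le_of_inner_le (ContinuousLinearMap.id ℂ E) (fun _ _ => rfl) hδ hf.nonneg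
    hT hu (fun t _ => by
      simpa only [ContinuousLinearMap.id_apply, hsq] using hf.inner_le (u t))
  simpa only [ContinuousLinearMap.id_apply, hsq] using this

/-- Solutions issued from the ball of radius `r` stay in the ball of radius
`trappingRadius δ C r`. -/
def trappingRadius (δ C r : ℝ) : ℝ := √(r ^ 2 + C / δ + 1)

theorem trappingRadius_pos (hδ : 0 < δ) (hC : 0 ≤ C) (r : ℝ) : 0 < trappingRadius δ C r :=
  Real.sqrt_pos.2 (by positivity)

theorem trappingRadius_sq (hδ : 0 < δ) (hC : 0 ≤ C) (r : ℝ) :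
    trappingRadius δ C r ^ 2 = r ^ 2 + C / δ + 1 :=
  Real.sq_sqrt (by positivity)

theorem le_trappingRadius (hδ : 0 < δ) (hC : 0 ≤ C) (r : ℝ) : r ≤ trappingRadius δ C r := by
  refine Real.le_sqrt_of_sq_le ?_
  have : 0 ≤ C / δ := by positivity
  linarith

theorem IsDissipative.norm_le_trappingRadius (hf : IsDissipative f δ C) (hδ : 0 < δ) {r T : ℝ}
    {u : ℝ → E} (hu : SolvesOn f T u) (h0 : ‖u 0‖ ≤ r) {t : ℝ} (ht : t ∈ Set.Icc 0 T) :
    ‖u t‖ ≤ trappingRadius δ C r := by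
  refine Real.le_sqrt_of_sq_le ?_
  have h1 := hf.norm_sq_le hδ ht.1 (hu.mono ht.2)
  have h2 : Real.exp (-δ * t) ≤ 1 := Real.exp_le_one_iff.2 (by nlinarith [ht.1])
  have h3 : ‖u 0‖ ^ 2 ≤ r ^ 2 := by gcongr
  nlinarith [sq_nonneg ‖u 0‖]

theorem IsDissipative.exists_dist_le (hf : IsDissipative f δ C) (hδ : 0 < δ) (r : ℝ) :
    ∃ K : ℝ≥0, ∀ (T : ℝ) (u v : ℝ → E), 0 ≤ T → SolvesOn f T u → SolvesOn f T v →
      ‖u 0‖ ≤ r → ‖v 0‖ ≤ r → dist (u T) (v T) ≤ dist (u 0) (v 0) * Real.exp (K * T) := by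
  obtain ⟨K, hK⟩ := hf.lipschitz (trappingRadius δ C r)
  refine ⟨K, fun T u v hT hu hv hu0 hv0 => ?_⟩
  have := dist_le_of_trajectories_ODE_of_mem (v := fun _ => f) (K := K) (a := 0) (b := T)
    (s := fun _ => Metric.closedBall 0 (trappingRadius δ C r)) (fun _ _ => hK) hu.continuousOn
    (fun t ht => hasDerivWithinAt_Ici_of_Icc (hu t (Set.Ico_subset_Icc_self ht)) ht)
    (fun t ht => mem_closedBall_zero_iff.2
      (hf.norm_le_trappingRadius hδ hu hu0 (Set.Ico_subset_Icc_self ht))) hv.continuousOn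
    (fun t ht => hasDerivWithinAt_Ici_of_Icc (hv t (Set.Ico_subset_Icc_self ht)) ht)
    (fun t ht => mem_closedBall_zero_iff.2
      (hf.norm_le_trappingRadius hδ hv hv0 (Set.Ico_subset_Icc_self ht))) le_rfl T ⟨hT, le_rfl⟩
  simpa using this

theorem IsDissipative.eq_of_solvesOn (hf : IsDissipative f δ C) (hδ : 0 < δ) {T : ℝ}
    {u v : ℝ → E} (hu : SolvesOn f T u) (hv : SolvesOn f T v) (h0 : u 0 = v 0) {t : ℝ}
    (ht : t ∈ Set.Icc 0 T) : u t = v t := by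
  obtain ⟨K, hK⟩ := hf.exists_dist_le hδ ‖u 0‖
  have := hK t u v ht.1 (hu.mono ht.2) (hv.mono ht.2) le_rfl (h0 ▸ le_rfl)
  rw [h0, dist_self, zero_mul] at this
  exact dist_le_zero.1 this

/-- Existence on `[0, T]`. The field composed with the radial retraction onto a large ball is
bounded and Lipschitz, so that the Picard–Lindelöf theorem applies on an interval of any length;
since the field points inwards on the sphere, the solution never leaves the ball. -/
theorem IsDissipative.exists_solvesOn [CompleteSpace E] (hf : IsDissipative f δ C) (hδ : 0 < δ)
    {T : ℝ} (hT : 0 ≤ T) (x : E) : ∃ u : ℝ → E, u 0 = x ∧ SolvesOn f T u := by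
  set R := trappingRadius δ C ‖x‖ with hRdef
  have hR : 0 < R := trappingRadius_pos hδ hf.nonneg _
  obtain ⟨K, hK⟩ := hf.lipschitz R
  have hmaps : ∀ y : E, radialRetraction R y ∈ Metric.closedBall (0 : E) R :=
    fun y => mem_closedBall_zero_iff.2 (norm_radialRetraction_le hR y)
  have hlip : LipschitzWith (K * 2) (fun y => f (radialRetraction R y)) := by
    refine LipschitzWith.of_dist_le_mul fun y z => ?_
    refine (hK.dist_le_mul _ (hmaps y) _ (hmaps z)).trans ?_
    have := (lipschitzWith_radialRetraction (E := E) hR).dist_le_mul y z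
    push_cast at this ⊢
    rw [mul_assoc]
    gcongr
  have hbound : ∀ y : E, ‖f (radialRetraction R y)‖ ≤ ‖f 0‖ + K * R := by
    intro y
    have h1 := hK.dist_le_mul _ (hmaps y) 0 (Metric.mem_closedBall_self hR.le)
    rw [dist_eq_norm, dist_zero_right] at h1
    have h2 := norm_le_norm_add_norm_sub (f 0) (f (radialRetraction R y))
    rw [norm_sub_rev] at h2
    have h3 : (K : ℝ) * ‖radialRetraction R y‖ ≤ K * R := by
      gcongr; exact norm_radialRetraction_le hR y
    linarith
  have hPL : IsPicardLindelof (fun _ => fun y => f (radialRetraction R y))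
      (⟨0, le_rfl, hT⟩ : Set.Icc (0 : ℝ) T) x ((‖f 0‖₊ + K * ⟨R, hR.le⟩) * ⟨T, hT⟩) 0
      (‖f 0‖₊ + K * ⟨R, hR.le⟩) (K * 2) :=
    IsPicardLindelof.of_time_independent (fun y _ => hbound y) hlip.lipschitzOnWith (by
      simp only [sub_zero, sub_self, max_eq_left hT, NNReal.coe_zero]
      exact le_rfl)
  obtain ⟨u, hu0, hu⟩ := hPL.exists_eq_forall_mem_Icc_hasDerivWithinAt₀
  simp only at hu0
  refine ⟨u, hu0, ?_⟩
  have hsq : ∀ x : E, (inner ℂ x x).re = ‖x‖ ^ 2 := fun x => inner_self_eq_norm_sq (𝕜 := ℂ) x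
  have hd := fun t ht => hasDerivWithinAt_quadraticForm (ContinuousLinearMap.id ℂ E)
    (fun _ _ => rfl) (hu t ht)
  simp only [ContinuousLinearMap.id_apply, hsq] at hd
  have hstay : ∀ t ∈ Set.Icc 0 T, ‖u t‖ ^ 2 ≤ R ^ 2 := by
    refine image_le_of_deriv_right_lt_deriv_boundary (B := fun _ => R ^ 2) (B' := fun _ => 0)
      (fun t ht => (hd t ht).continuousWithinAt)
      (fun t ht => hasDerivWithinAt_Ici_of_Icc (hd t (Set.Ico_subset_Icc_self ht)) ht) ?_
      (fun t => hasDerivAt_const t _) ?_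
    · rw [hu0]
      gcongr
      exact le_trappingRadius hδ hf.nonneg _
    · intro t _ hbd
      have hle : ‖u t‖ ≤ R := (pow_le_pow_iff_left₀ (norm_nonneg _) hR.le two_ne_zero).1 hbd.le
      rw [radialRetraction_eq_self hR hle]
      refine (hf.inner_le (u t)).trans_lt ?_
      rw [hbd, hRdef, trappingRadius_sq hδ hf.nonneg]
      have : δ * (C / δ) = C := by field_simp
      nlinarith [sq_nonneg ‖x‖, mul_nonneg hδ.le (sq_nonneg ‖x‖)]
  intro t ht
  have hle : ‖u t‖ ≤ R := (pow_le_pow_iff_left₀ (norm_nonneg _) hR.le two_ne_zero).1 (hstay t ht)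
  simpa only [radialRetraction_eq_self hR hle] using hu t ht

theorem IsDissipative.exists_solvesForward [CompleteSpace E] (hf : IsDissipative f δ C)
    (hδ : 0 < δ) (x : E) : ∃ u : ℝ → E, u 0 = x ∧ SolvesForward f u := by
  have hex : ∀ T : ℝ, ∃ u : ℝ → E, u 0 = x ∧ (0 ≤ T → SolvesOn f T u) := fun T => by
    by_cases hT : 0 ≤ T
    · obtain ⟨u, h0, hu⟩ := hf.exists_solvesOn hδ hT x
      exact ⟨u, h0, fun _ => hu⟩
    · exact ⟨fun _ => x, rfl, fun h => absurd h hT⟩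
  choose U hU0 hU using hex
  refine ⟨fun t => U (t + 1) t, hU0 _, fun t ht => ?_⟩
  -- Near `t` the glued curve coincides with the solution on `[0, t + 1]`.
  have heq : ∀ s, 0 ≤ s → s < t + 1 → U (s + 1) s = U (t + 1) s := by
    intro s hs hst
    rcases le_total s t with h | h
    · exact hf.eq_of_solvesOn hδ (hU _ (by linarith)) ((hU _ (by linarith)).mono (by linarith))
        (by rw [hU0, hU0]) ⟨hs, by linarith⟩
    · exact hf.eq_of_solvesOn (T := t + 1) hδ ((hU _ (by linarith)).mono (by linarith))
        (hU _ (by linarith)) (by rw [hU0, hU0]) ⟨hs, hst.le⟩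
  have h1 := hU (t + 1) (by linarith) t ⟨ht, by linarith⟩
  have h2 : HasDerivWithinAt (U (t + 1)) (f (U (t + 1) t)) (Set.Ici 0) t := by
    refine h1.mono_of_mem_nhdsWithin ?_
    rw [← Set.Ici_inter_Iic]
    exact inter_mem_nhdsWithin _ (Iic_mem_nhds (by linarith))
  refine h2.congr_of_eventuallyEq ?_ (heq t ht (by linarith))
  filter_upwards [self_mem_nhdsWithin, mem_nhdsWithin_of_mem_nhds (Iio_mem_nhds (lt_add_one t))]
    with s hs hst using heq s hs hst

theorem IsDissipative.exists_isSolutionSemigroup [CompleteSpace E] (hf : IsDissipative f δ C)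
    (hδ : 0 < δ) : ∃ S : ℝ≥0 → E → E, IsSolutionSemigroup (SolvesForward f) S := by
  choose U hU0 hU using hf.exists_solvesForward hδ
  refine ⟨fun t x => U x t, fun x => by simpa using hU0 x, fun x t ht => ?_, fun u hu t => ?_⟩
  · have h1 := hU x t ht
    refine (h1.congr_deriv (by simp [Real.coe_toNNReal t ht])).congr (fun s hs => ?_) ?_
    · simp [Real.coe_toNNReal s hs]
    · simp [Real.coe_toNNReal t ht]
  · exact hf.eq_of_solvesOn hδ (hu.solvesOn t) ((hU (u 0)).solvesOn t) (hU0 _).symm ⟨t.2, le_rfl⟩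

end Dissipative

theorem tendsto_exp_neg_mul_mul_atTop {δ : ℝ} (hδ : 0 < δ) (c : ℝ) :
    Tendsto (fun t : ℝ≥0 => Real.exp (-δ * t) * c) atTop (𝓝 0) := by
  have h1 : Tendsto (fun t : ℝ≥0 => δ * (t : ℝ)) atTop atTop :=
    (NNReal.tendsto_coe_atTop.2 tendsto_id).const_mul_atTop hδ
  simpa [Function.comp_def] using (Real.tendsto_exp_neg_atTop_nhds_zero.comp h1).mul_const c

section Semigroup

variable {E : Type*} [NormedAddCommGroup E] [InnerProductSpace ℂ E] [NormedSpace ℝ E]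
  [IsScalarTower ℝ ℂ E] {f : E → E} {δ C : ℝ} {S : ℝ≥0 → E → E}

theorem IsDissipative.norm_semigroup_sq_le (hf : IsDissipative f δ C) (hδ : 0 < δ)
    (hS : IsSolutionSemigroup (SolvesForward f) S) (t : ℝ≥0) (x : E) :
    ‖S t x‖ ^ 2 ≤ Real.exp (-δ * t) * ‖x‖ ^ 2 + C / δ := by
  have h := hf.norm_sq_le hδ t.2 ((hS.solves x).solvesOn t)
  simpa [hS.initial] using h

theorem IsDissipative.continuous_semigroup (hf : IsDissipative f δ C) (hδ : 0 < δ)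
    (hS : IsSolutionSemigroup (SolvesForward f) S) (t : ℝ≥0) : Continuous (S t) := by
  refine continuous_iff_continuousAt.2 fun x => ?_
  obtain ⟨K, hK⟩ := hf.exists_dist_le hδ (‖x‖ + 1)
  refine continuousAt_of_locally_lipschitz one_pos (Real.exp (K * t)) fun y hy => ?_
  have hy' : ‖y‖ ≤ ‖x‖ + 1 := by
    rw [dist_eq_norm] at hy
    linarith [norm_le_norm_add_norm_sub x y, norm_sub_rev x y]
  have h := hK t _ _ t.2 ((hS.solves y).solvesOn t) ((hS.solves x).solvesOn t)
    (by simpa [hS.initial] using hy') (by simp [hS.initial])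
  simpa [hS.initial, mul_comm] using h

/-- The square of the radius is one more than the asymptotic bound `C / δ` on `‖S t x‖²`, so that
every bounded set enters the ball in finite time. -/
theorem IsDissipative.exists_absorbing (hf : IsDissipative f δ C) (hδ : 0 < δ)
    (hS : IsSolutionSemigroup (SolvesForward f) S) {B : Set E} (hB : Bornology.IsBounded B) :
    ∃ T : ℝ≥0, ∀ t, T ≤ t → ∀ x ∈ B, S t x ∈ Metric.closedBall 0 (trappingRadius δ C 0) := by
  obtain ⟨r, hr⟩ := hB.exists_norm_le
  obtain ⟨T, hT⟩ := eventually_atTop.1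
    ((tendsto_exp_neg_mul_mul_atTop hδ (r ^ 2)).eventually_le_const one_pos)
  refine ⟨T, fun t ht x hx => mem_closedBall_zero_iff.2 (Real.le_sqrt_of_sq_le ?_)⟩
  have h1 := hf.norm_semigroup_sq_le hδ hS t x
  have h2 : Real.exp (-δ * t) * ‖x‖ ^ 2 ≤ Real.exp (-δ * t) * r ^ 2 := by
    gcongr; exact hr x hx
  have h3 := hT t ht
  linarith

end Semigroup

/-! ### Existence and uniqueness of global attractors -/

section Attractor

variable {X : Type*} [MetricSpace X] {S : ℝ≥0 → X → X}

theorem semidist_eq_iSup_infEDist (A B : Set X) : semidist A B = ⨆ x ∈ A, Metric.infEDist x B :=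
  rfl

theorem semidist_le_iff {A B : Set X} {r : ℝ≥0∞} :
    semidist A B ≤ r ↔ ∀ x ∈ A, Metric.infEDist x B ≤ r := by
  rw [semidist_eq_iSup_infEDist, iSup₂_le_iff]

theorem IsGlobalAttractor.subset_of_tendsto {A A' : Set X} (hA : IsGlobalAttractor S A)
    (hA' : IsGlobalAttractor S A') : A ⊆ A' := by
  have h := hA'.attracts A hA.isCompact.isBounded
  simp only [hA.invariant] at h
  have h0 : semidist A A' = 0 := tendsto_nhds_unique tendsto_const_nhds h
  intro x hx
  have hx0 : Metric.infEDist x A' = 0 := le_antisymm (semidist_le_iff.1 h0.le x hx) zero_le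
  rwa [← hA'.isCompact.isClosed.closure_eq, Metric.mem_closure_iff_infEDist_zero]

theorem IsGlobalAttractor.unique {A A' : Set X} (hA : IsGlobalAttractor S A)
    (hA' : IsGlobalAttractor S A') : A = A' :=
  (hA.subset_of_tendsto hA').antisymm (hA'.subset_of_tendsto hA)

theorem IsGlobalAttractor.subset_of_absorbing {A B : Set X} (hA : IsGlobalAttractor S A)
    (hB : ∃ T : ℝ≥0, ∀ t, T ≤ t → ∀ x ∈ A, S t x ∈ B) : A ⊆ B := by
  obtain ⟨T, hT⟩ := hB
  intro x hx
  rw [← hA.invariant T] at hx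
  obtain ⟨y, hy, rfl⟩ := hx
  exact hT T le_rfl y hy

/-- Orbit samples at times tending to infinity that get arbitrarily close to compact sets have
convergent subsequences. -/
theorem exists_subseq_tendsto_of_near_compact [CompleteSpace X] {z : ℕ → X}
    (hz : ∀ ε > 0, ∃ C : Set X, IsCompact C ∧ ∀ᶠ k in atTop, ∃ c ∈ C, dist (z k) c < ε) :
    ∃ y, ∃ φ : ℕ → ℕ, StrictMono φ ∧ Tendsto (z ∘ φ) atTop (𝓝 y) := by
  have htb : TotallyBounded (Set.range z) := by
    refine Metric.totallyBounded_iff.2 fun ε hε => ?_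
    obtain ⟨C, hC, hev⟩ := hz (ε / 2) (half_pos hε)
    obtain ⟨N, hN⟩ := eventually_atTop.1 hev
    obtain ⟨t, ht, hCt⟩ := Metric.totallyBounded_iff.1 hC.totallyBounded (ε / 2) (half_pos hε)
    refine ⟨t ∪ z '' Set.Iio N, ht.union ((Set.finite_Iio N).image z), ?_⟩
    rintro _ ⟨k, rfl⟩
    rcases lt_or_ge k N with hk | hk
    · exact Set.mem_biUnion (Or.inr ⟨k, hk, rfl⟩) (Metric.mem_ball_self hε)
    · obtain ⟨c, hc, hd⟩ := hN k hk
      obtain ⟨y, hy, hcy⟩ := Set.mem_iUnion₂.1 (hCt hc)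
      refine Set.mem_biUnion (Or.inl hy) ?_
      rw [Metric.mem_ball] at hcy ⊢
      linarith [dist_triangle (z k) c y]
  obtain ⟨y, -, φ, hφ, hlim⟩ := (htb.closure.isCompact_of_isClosed isClosed_closure).tendsto_subseq
    (fun k => subset_closure (Set.mem_range_self k))
  exact ⟨y, φ, hφ, hlim⟩

/-- The `ω`-limit set of `B`: all limits of `S (t k) (x k)` with `x k ∈ B` and `t k → ∞`. -/
def omegaLimitSet (S : ℝ≥0 → X → X) (B : Set X) : Set X :=
  {y | ∃ (t : ℕ → ℝ≥0) (x : ℕ → X), Tendsto t atTop atTop ∧ (∀ k, x k ∈ B) ∧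
    Tendsto (fun k => S (t k) (x k)) atTop (𝓝 y)}

/-- A continuous semigroup on a complete metric space has a global attractor as soon as it has an
absorbing set `B` whose images come arbitrarily close to compact sets: the `ω`-limit set of `B`. -/
theorem isGlobalAttractor_omegaLimitSet [CompleteSpace X] [Nonempty X]
    (hadd : ∀ s t x, S (s + t) x = S s (S t x)) (hcont : ∀ t, Continuous (S t)) {B : Set X}
    (habs : ∀ D : Set X, Bornology.IsBounded D → ∃ T : ℝ≥0, ∀ t, T ≤ t → ∀ x ∈ D, S t x ∈ B)
    (hcpt : ∀ ε > 0, ∃ C : Set X, IsCompact C ∧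
      ∃ T : ℝ≥0, ∀ t, T ≤ t → ∀ x ∈ B, ∃ c ∈ C, dist (S t x) c < ε) :
    IsGlobalAttractor S (omegaLimitSet S B) := by
  have hAC : ∀ (t : ℕ → ℝ≥0) (x : ℕ → X), Tendsto t atTop atTop → (∀ k, x k ∈ B) →
      ∃ y, ∃ φ : ℕ → ℕ, StrictMono φ ∧ y ∈ omegaLimitSet S B ∧
        Tendsto (fun k => S (t (φ k)) (x (φ k))) atTop (𝓝 y) := by
    intro t x ht hx
    obtain ⟨y, φ, hφ, hlim⟩ := exists_subseq_tendsto_of_near_compact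
      (z := fun k => S (t k) (x k)) (fun ε hε => by
        obtain ⟨C, hC, T, hT⟩ := hcpt ε hε
        refine ⟨C, hC, ?_⟩
        filter_upwards [ht.eventually_ge_atTop T] with k hk using hT _ hk _ (hx k))
    exact ⟨y, φ, hφ, ⟨t ∘ φ, x ∘ φ, ht.comp hφ.tendsto_atTop, fun k => hx _, hlim⟩, hlim⟩
  have hnat : Tendsto (fun k : ℕ => (k : ℝ≥0)) atTop atTop := tendsto_natCast_atTop_atTop
  refine ⟨?_, ?_, fun t => ?_, fun D hD => ?_⟩
  · obtain ⟨x₀⟩ := ‹Nonempty X›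
    obtain ⟨T, hT⟩ := habs {x₀} Bornology.isBounded_singleton
    obtain ⟨y, -, -, hy, -⟩ := hAC (fun k => k) (fun _ => S T x₀) hnat
      (fun _ => hT T le_rfl _ rfl)
    exact ⟨y, hy⟩
  · refine IsSeqCompact.isCompact fun y hy => ?_
    have hstep : ∀ j : ℕ, ∃ (s : ℝ≥0) (x : X), (j : ℝ≥0) ≤ s ∧ x ∈ B ∧
        dist (S s x) (y j) < 1 / ((j : ℝ) + 1) := by
      intro j
      obtain ⟨t, x, ht, hx, hlim⟩ := hy j
      obtain ⟨k, hk1, hk2⟩ := ((ht.eventually_ge_atTop (j : ℝ≥0)).and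
        (Metric.tendsto_nhds.1 hlim _ Nat.one_div_pos_of_nat)).exists
      exact ⟨t k, x k, hk1, hx k, hk2⟩
    choose s x hs hx hd using hstep
    obtain ⟨w, φ, hφ, hw, hlim⟩ := hAC s x (tendsto_atTop_mono hs hnat) hx
    refine ⟨w, hw, φ, hφ, (tendsto_iff_of_dist ?_).1 hlim⟩
    refine squeeze_zero (fun _ => dist_nonneg) (fun j => (hd (φ j)).le) ?_
    exact tendsto_one_div_add_atTop_nhds_zero_nat.comp hφ.tendsto_atTop
  · apply Set.Subset.antisymm
    · rintro _ ⟨y, ⟨s, x, hs, hx, hlim⟩, rfl⟩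
      refine ⟨fun k => t + s k, x, tendsto_atTop_mono (fun k => le_add_self) hs, hx, ?_⟩
      simp only [hadd]
      exact ((hcont t).tendsto y).comp hlim
    · rintro y ⟨s, x, hs, hx, hlim⟩
      have hs' : Tendsto (fun k => s k - t) atTop atTop := by
        refine tendsto_atTop.2 fun b => ?_
        filter_upwards [hs.eventually_ge_atTop (b + t)] with k hk using le_tsub_of_add_le_right hk
      obtain ⟨w, φ, hφ, hw, hlimw⟩ := hAC _ x hs' hx
      refine ⟨w, hw, tendsto_nhds_unique (((hcont t).tendsto w).comp hlimw) ?_⟩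
      refine (hlim.comp hφ.tendsto_atTop).congr' ?_
      filter_upwards [(hs.comp hφ.tendsto_atTop).eventually_ge_atTop t] with k hk
      simp only [Function.comp_apply] at hk ⊢
      rw [← hadd, add_tsub_cancel_of_le hk]
  · by_contra hcon
    -- Otherwise some orbit samples stay at distance `ε`, although a subsequence converges.
    simp only [ENNReal.tendsto_atTop_zero, not_forall, not_exists, not_le] at hcon
    obtain ⟨ε, hε, hfar⟩ := hcon
    obtain ⟨T, hT⟩ := habs D hD
    have hstep : ∀ k : ℕ, ∃ (s : ℝ≥0) (x : X), (k : ℝ≥0) ≤ s ∧ x ∈ B ∧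
        ε < Metric.infEDist (S s x) (omegaLimitSet S B) := by
      intro k
      obtain ⟨t, ht, hlt⟩ := hfar (k + T)
      have hnot := mt semidist_le_iff.2 hlt.not_ge
      push Not at hnot
      obtain ⟨_, ⟨x, hx, rfl⟩, hxlt⟩ := hnot
      refine ⟨t - T, S T x, le_tsub_of_add_le_right ht, hT T le_rfl x hx, ?_⟩
      rwa [← hadd, tsub_add_cancel_of_le (le_add_self.trans ht)]
    choose s x hs hx hd using hstep
    obtain ⟨w, φ, hφ, hw, hlim⟩ := hAC s x (tendsto_atTop_mono hs hnat) hx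
    have h0 : Tendsto (fun k => edist (S (s (φ k)) (x (φ k))) w) atTop (𝓝 0) :=
      tendsto_iff_edist_tendsto_0.1 hlim
    obtain ⟨k, hk⟩ := (h0.eventually_lt_const hε).exists
    exact (hd (φ k)).not_gt ((Metric.infEDist_le_edist_of_mem hw).trans_lt hk)

end Attractor

/-! ### The vector field of the lattice system -/

section Sequences

theorem Ell2.hasSum_norm_sq (u : Ell2) : HasSum (fun n => ‖u n‖ ^ 2) (‖u‖ ^ 2) := by
  have h := lp.hasSum_norm (p := 2) (by norm_num) u
  simpa using h

theorem Ell2.norm_apply_le (u : Ell2) (n : ℤ) : ‖u n‖ ≤ ‖u‖ :=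
  lp.norm_apply_le_norm two_ne_zero u n

theorem Ell2.norm_le_mul_of_forall_le {u v : Ell2} {C : ℝ} (hC : 0 ≤ C)
    (h : ∀ n, ‖u n‖ ≤ C * ‖v n‖) : ‖u‖ ≤ C * ‖v‖ := by
  have h1 : ‖u‖ ≤ ‖C • v‖ := lp.norm_mono two_ne_zero fun n => by
    simpa [norm_smul, abs_of_nonneg hC] using h n
  simpa [norm_smul, abs_of_nonneg hC] using h1

theorem hasSum_norm_sq_shift (u : Ell2) (k : ℤ) :
    HasSum (fun n => ‖u (n + k)‖ ^ 2) (‖u‖ ^ 2) :=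
  (Equiv.addRight k).hasSum_iff.2 u.hasSum_norm_sq

theorem memℓp_shift (k : ℤ) (u : Ell2) : Memℓp (fun n => u (n + k)) 2 := by
  refine memℓp_gen ?_
  simpa using (hasSum_norm_sq_shift u k).summable

/-- The translation of sequences, `(shift k u) n = u (n + k)`. -/
def shift (k : ℤ) (u : Ell2) : Ell2 := ⟨fun n => u (n + k), memℓp_shift k u⟩

@[simp] theorem shift_apply (k : ℤ) (u : Ell2) (n : ℤ) : shift k u n = u (n + k) := rfl

theorem shift_sub (k : ℤ) (u v : Ell2) : shift k (u - v) = shift k u - shift k v := rfl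

theorem norm_shift (k : ℤ) (u : Ell2) : ‖shift k u‖ = ‖u‖ := by
  have h := (shift k u).hasSum_norm_sq.unique (hasSum_norm_sq_shift u k)
  exact (pow_left_inj₀ (norm_nonneg _) (norm_nonneg _) two_ne_zero).1 h

end Sequences

section Nonlinearity

theorem rpow_sub_rpow_mul_le {p a b : ℝ} (hp : 0 ≤ p) (hb : 0 ≤ b) (hba : b ≤ a) :
    (a ^ p - b ^ p) * b ≤ p * a ^ p * (a - b) := by
  rcases hb.eq_or_lt with rfl | hb0
  · have : 0 ≤ a ^ p := Real.rpow_nonneg hba _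
    simp only [mul_zero, sub_zero]
    positivity
  have ha : 0 < a := hb0.trans_le hba
  have hbern : 1 + (p + 1) * (b / a - 1) ≤ (b / a) ^ (p + 1) := by
    have h := one_add_mul_self_le_rpow_one_add (s := b / a - 1)
      (by linarith [div_nonneg hb ha.le]) (p := p + 1) (by linarith)
    simpa using h
  rw [Real.div_rpow hb ha.le, Real.rpow_add_one hb0.ne', Real.rpow_add_one ha.ne',
    le_div_iff₀ (by positivity)] at hbern
  have : (1 + (p + 1) * (b / a - 1)) * (a ^ p * a) = a ^ p * a + (p + 1) * a ^ p * (b - a) := by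
    field_simp
  nlinarith

/-- The map `z ↦ |z|^p z` is Lipschitz on discs, for every real exponent `p ≥ 0`. -/
theorem norm_rpow_mul_sub_le {p R : ℝ} (hp : 0 ≤ p) {z w : ℂ} (hz : ‖z‖ ≤ R) (hw : ‖w‖ ≤ R) :
    ‖((‖z‖ ^ p : ℝ) : ℂ) * z - ((‖w‖ ^ p : ℝ) : ℂ) * w‖ ≤ (p + 1) * R ^ p * ‖z - w‖ := by
  wlog hwz : ‖w‖ ≤ ‖z‖ generalizing z w
  · rw [norm_sub_rev, norm_sub_rev z w]
    exact this hw hz (le_of_not_ge hwz)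
  have hsplit : ((‖z‖ ^ p : ℝ) : ℂ) * z - ((‖w‖ ^ p : ℝ) : ℂ) * w
      = ((‖z‖ ^ p : ℝ) : ℂ) * (z - w) + ((‖z‖ ^ p - ‖w‖ ^ p : ℝ) : ℂ) * w := by
    push_cast; ring
  have hmono : ‖w‖ ^ p ≤ ‖z‖ ^ p := Real.rpow_le_rpow (norm_nonneg _) hwz hp
  have hzR : ‖z‖ ^ p ≤ R ^ p := Real.rpow_le_rpow (norm_nonneg _) hz hp
  have hz0 : 0 ≤ ‖z‖ ^ p := Real.rpow_nonneg (norm_nonneg _) _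
  have h1 := rpow_sub_rpow_mul_le hp (norm_nonneg w) hwz
  have h2 : ‖z‖ - ‖w‖ ≤ ‖z - w‖ := norm_sub_norm_le z w
  rw [hsplit]
  refine (norm_add_le _ _).trans ?_
  rw [norm_mul, norm_mul, Complex.norm_real, Complex.norm_real, Real.norm_of_nonneg hz0,
    Real.norm_of_nonneg (sub_nonneg.2 hmono)]
  calc ‖z‖ ^ p * ‖z - w‖ + (‖z‖ ^ p - ‖w‖ ^ p) * ‖w‖
      ≤ ‖z‖ ^ p * ‖z - w‖ + p * ‖z‖ ^ p * ‖z - w‖ := by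
        have h3 : p * ‖z‖ ^ p * (‖z‖ - ‖w‖) ≤ p * ‖z‖ ^ p * ‖z - w‖ := by gcongr
        linarith
    _ = (p + 1) * ‖z‖ ^ p * ‖z - w‖ := by ring
    _ ≤ (p + 1) * R ^ p * ‖z - w‖ := by gcongr

variable {p : ℝ}

theorem memℓp_powerNonlinearity (hp : 0 ≤ p) (u : Ell2) :
    Memℓp (fun n => ((‖u n‖ ^ p : ℝ) : ℂ) * u n) 2 := by
  refine Memℓp.mono' (lp.memℓp (((‖u‖ ^ p : ℝ) : ℂ) • u)) fun n => ?_
  have h : ‖u n‖ ^ p ≤ ‖u‖ ^ p := Real.rpow_le_rpow (norm_nonneg _) (u.norm_apply_le n) hp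
  have h0 : 0 ≤ ‖u n‖ ^ p := Real.rpow_nonneg (norm_nonneg _) _
  rw [lp.coeFn_smul, Pi.smul_apply, smul_eq_mul, norm_mul, norm_mul, Complex.norm_real,
    Complex.norm_real, Real.norm_of_nonneg h0, Real.norm_of_nonneg (h0.trans h)]
  gcongr

/-- The power nonlinearity `u ↦ (|u n|^p u n)` of `ℓ²`. -/
def powerNonlinearity (hp : 0 ≤ p) (u : Ell2) : Ell2 :=
  ⟨fun n => ((‖u n‖ ^ p : ℝ) : ℂ) * u n, memℓp_powerNonlinearity hp u⟩

theorem norm_powerNonlinearity_sub_le (hp : 0 ≤ p) {R : ℝ} {u v : Ell2} (hu : ‖u‖ ≤ R)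
    (hv : ‖v‖ ≤ R) :
    ‖powerNonlinearity hp u - powerNonlinearity hp v‖ ≤ (p + 1) * R ^ p * ‖u - v‖ := by
  have hR : 0 ≤ R := (norm_nonneg u).trans hu
  refine Ell2.norm_le_mul_of_forall_le (by positivity) fun n => ?_
  exact norm_rpow_mul_sub_le hp ((u.norm_apply_le n).trans hu) ((v.norm_apply_le n).trans hv)

end Nonlinearity

section Field

variable {σ δ : ℝ}

/-- The vector field `u ↦ i (Δ u + |u|^{2σ} u - g) - δ u` on `ℓ²`. -/
def latticeField (hσ : 0 ≤ σ) (δ : ℝ) (g u : Ell2) : Ell2 :=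
  Complex.I • (shift 1 u + shift (-1) u - (2 : ℂ) • u
    + powerNonlinearity (mul_nonneg zero_le_two hσ) u - g) - (δ : ℂ) • u

theorem latticeField_apply (hσ : 0 ≤ σ) (δ : ℝ) (g u : Ell2) (n : ℤ) :
    latticeField hσ δ g u n = Complex.I * (u (n + 1) + u (n - 1) - 2 * u n
      + ((‖u n‖ ^ (2 * σ) : ℝ) : ℂ) * u n - g n) - (δ : ℂ) * u n := rfl

theorem equation_iff (hσ : 0 ≤ σ) (g u : Ell2) (v : ℂ) (n : ℤ) :
    Equation σ δ g u v n ↔ v = latticeField hσ δ g u n := by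
  rw [Equation, latticeField_apply]
  constructor
  · intro h
    linear_combination (-Complex.I) * h + (v + δ * u n) * Complex.I_mul_I
  · intro h
    linear_combination Complex.I * h + (u (n + 1) + u (n - 1) - 2 * u n
      + ((‖u n‖ ^ (2 * σ) : ℝ) : ℂ) * u n - g n) * Complex.I_mul_I

theorem exists_lipschitzOnWith_latticeField (hσ : 0 ≤ σ) (δ : ℝ) (g : Ell2) (R : ℝ) :
    ∃ K : ℝ≥0, LipschitzOnWith K (latticeField hσ δ g) (Metric.closedBall 0 R) := by
  have h2σ : 0 ≤ 2 * σ := mul_nonneg zero_le_two hσ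
  refine ⟨Real.toNNReal (4 + (2 * σ + 1) * |R| ^ (2 * σ) + |δ|),
    LipschitzOnWith.of_dist_le_mul fun u hu v hv => ?_⟩
  rw [mem_closedBall_zero_iff] at hu hv
  rw [Real.coe_toNNReal _ (by positivity), dist_eq_norm, dist_eq_norm]
  have hN := norm_powerNonlinearity_sub_le h2σ (hu.trans (le_abs_self R))
    (hv.trans (le_abs_self R))
  have hsplit : latticeField hσ δ g u - latticeField hσ δ g v
      = Complex.I • (shift 1 (u - v) + shift (-1) (u - v) - (2 : ℂ) • (u - v)
        + (powerNonlinearity h2σ u - powerNonlinearity h2σ v)) - (δ : ℂ) • (u - v) := by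
    simp only [latticeField, shift_sub, smul_sub, smul_add]
    abel
  rw [hsplit]
  have h1 := norm_shift 1 (u - v)
  have h2 := norm_shift (-1) (u - v)
  have h3 : ‖(2 : ℂ) • (u - v)‖ = 2 * ‖u - v‖ := by rw [norm_smul]; simp
  have h4 : ‖(δ : ℂ) • (u - v)‖ = |δ| * ‖u - v‖ := by rw [norm_smul]; simp
  refine (norm_sub_le _ _).trans ?_
  rw [norm_smul, Complex.norm_I, one_mul, h4]
  have h5 := norm_add_le (shift 1 (u - v) + shift (-1) (u - v) - (2 : ℂ) • (u - v))
    (powerNonlinearity h2σ u - powerNonlinearity h2σ v)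
  have h6 := norm_sub_le (shift 1 (u - v) + shift (-1) (u - v)) ((2 : ℂ) • (u - v))
  have h7 := norm_add_le (shift 1 (u - v)) (shift (-1) (u - v))
  linarith

end Field

/-! ### Weighted energy estimates -/

section Weight

variable {θ : ℤ → ℝ}

theorem norm_ofReal_smul_id_le (hθ : ∀ n, θ n ∈ Set.Icc (0 : ℝ) 1) (n : ℤ) :
    ‖((θ n : ℝ) : ℂ) • ContinuousLinearMap.id ℂ ℂ‖ ≤ 1 := by
  rw [norm_smul, Complex.norm_real, Real.norm_of_nonneg (hθ n).1]
  exact mul_le_one₀ (hθ n).2 (norm_nonneg _) ContinuousLinearMap.norm_id_le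

/-- Multiplication of sequences by a weight `θ` with values in `[0, 1]`. -/
def weightMul (hθ : ∀ n, θ n ∈ Set.Icc (0 : ℝ) 1) : Ell2 →L[ℂ] Ell2 :=
  lp.mapCLM 2 (fun n => ((θ n : ℝ) : ℂ) • ContinuousLinearMap.id ℂ ℂ) zero_le_one
    (norm_ofReal_smul_id_le hθ)

@[simp] theorem weightMul_apply (hθ : ∀ n, θ n ∈ Set.Icc (0 : ℝ) 1) (u : Ell2) (n : ℤ) :
    weightMul hθ u n = (θ n : ℂ) * u n := rfl

theorem inner_weightMul_comm (hθ : ∀ n, θ n ∈ Set.Icc (0 : ℝ) 1) (u v : Ell2) :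
    inner ℂ (weightMul hθ u) v = inner ℂ u (weightMul hθ v) := by
  rw [lp.inner_eq_tsum, lp.inner_eq_tsum]
  refine tsum_congr fun n => ?_
  simp only [weightMul_apply, RCLike.inner_apply, map_mul, Complex.conj_ofReal]
  ring

theorem hasSum_re_inner_weightMul (hθ : ∀ n, θ n ∈ Set.Icc (0 : ℝ) 1) (u v : Ell2) :
    HasSum (fun n => θ n * ((u n).re * (v n).re + (u n).im * (v n).im))
      (inner ℂ (weightMul hθ u) v).re := by
  refine (Complex.hasSum_re (lp.hasSum_inner (weightMul hθ u) v)).congr_fun fun n => ?_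
  simp only [weightMul_apply, RCLike.inner_apply, map_mul, Complex.conj_ofReal, Complex.mul_re,
    Complex.mul_im, Complex.ofReal_re, Complex.ofReal_im, Complex.conj_re, Complex.conj_im]
  ring

theorem hasSum_re_inner_weightMul_self (hθ : ∀ n, θ n ∈ Set.Icc (0 : ℝ) 1) (u : Ell2) :
    HasSum (fun n => θ n * ‖u n‖ ^ 2) (inner ℂ (weightMul hθ u) u).re := by
  refine (hasSum_re_inner_weightMul hθ u u).congr_fun fun n => ?_
  rw [Complex.sq_norm, Complex.normSq_apply]

theorem re_inner_weightMul_self_le (hθ : ∀ n, θ n ∈ Set.Icc (0 : ℝ) 1) (u : Ell2) :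
    (inner ℂ (weightMul hθ u) u).re ≤ ‖u‖ ^ 2 :=
  hasSum_le (fun n => mul_le_of_le_one_left (sq_nonneg _) (hθ n).2)
    (hasSum_re_inner_weightMul_self hθ u) u.hasSum_norm_sq

theorem re_inner_weightMul_self_nonneg (hθ : ∀ n, θ n ∈ Set.Icc (0 : ℝ) 1) (u : Ell2) :
    0 ≤ (inner ℂ (weightMul hθ u) u).re :=
  (hasSum_re_inner_weightMul_self hθ u).nonneg fun n => mul_nonneg (hθ n).1 (sq_nonneg _)

/-- The weighted energy estimate. For a constant weight the discrete Laplacian does not contribute;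
in general it contributes the telescoping sum of `2 θ (n + 1) Im (conj (u n) * u (n + 1))` and a
commutator that is controlled by the variation `L` of the weight from site to site. -/
theorem re_inner_weightMul_latticeField_le {σ δ L : ℝ} (hσ : 0 ≤ σ) (hδ : 0 < δ)
    (hθ : ∀ n, θ n ∈ Set.Icc (0 : ℝ) 1) (hL : ∀ n, |θ (n + 1) - θ n| ≤ L) (g u : Ell2) :
    2 * (inner ℂ (weightMul hθ u) (latticeField hσ δ g u)).re
      ≤ -δ * (inner ℂ (weightMul hθ u) u).re
        + ((inner ℂ (weightMul hθ g) g).re / δ + 2 * L * ‖u‖ ^ 2) := by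
  set J : ℤ → ℝ := fun n => (u n).re * (u (n + 1)).im - (u n).im * (u (n + 1)).re with hJ
  set a : ℤ → ℝ := fun n => 2 * θ (n + 1) * J n with ha
  have hJle : ∀ n, 2 * |J n| ≤ ‖u n‖ ^ 2 + ‖u (n + 1)‖ ^ 2 := by
    intro n
    rw [Complex.sq_norm, Complex.sq_norm, Complex.normSq_apply, Complex.normSq_apply]
    rcases abs_cases (J n) with ⟨h, -⟩ | ⟨h, -⟩ <;> rw [h] <;> simp only [hJ] <;>
      nlinarith [sq_nonneg ((u n).re - (u (n + 1)).im), sq_nonneg ((u n).im + (u (n + 1)).re),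
        sq_nonneg ((u n).re + (u (n + 1)).im), sq_nonneg ((u n).im - (u (n + 1)).re)]
  have hsum : HasSum (fun n => ‖u n‖ ^ 2 + ‖u (n + 1)‖ ^ 2) (‖u‖ ^ 2 + ‖u‖ ^ 2) :=
    u.hasSum_norm_sq.add (hasSum_norm_sq_shift u 1)
  have hasum : Summable a := by
    refine Summable.of_norm_bounded hsum.summable fun n => le_trans ?_ (hJle n)
    have h1 := hθ (n + 1)
    rw [ha, Real.norm_eq_abs, abs_mul, abs_mul, abs_two, abs_of_nonneg h1.1]
    have h2 := mul_le_of_le_one_left (abs_nonneg (J n)) h1.2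
    linarith
  have htel : HasSum (fun n => a (n - 1) - a n) 0 := by
    have h1 : HasSum (fun n => a (n - 1)) (∑' n, a n) :=
      (Equiv.subRight (1 : ℤ)).hasSum_iff.2 hasum.hasSum
    simpa using h1.sub hasum.hasSum
  have hrhs := ((((hasSum_re_inner_weightMul_self hθ u).mul_left (-δ)).add
    ((hasSum_re_inner_weightMul_self hθ g).div_const δ)).add htel).add (hsum.mul_left L)
  refine (hasSum_le (fun n => ?_) ((hasSum_re_inner_weightMul hθ u
    (latticeField hσ δ g u)).mul_left 2) hrhs).trans_eq (by ring)
  have hcomm : 2 * (θ (n + 1) - θ n) * J n ≤ L * (‖u n‖ ^ 2 + ‖u (n + 1)‖ ^ 2) := by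
    have hL0 : 0 ≤ L := (abs_nonneg _).trans (hL n)
    calc 2 * (θ (n + 1) - θ n) * J n ≤ |2 * (θ (n + 1) - θ n) * J n| := le_abs_self _
      _ = |θ (n + 1) - θ n| * (2 * |J n|) := by rw [abs_mul, abs_mul, abs_two]; ring
      _ ≤ L * (‖u n‖ ^ 2 + ‖u (n + 1)‖ ^ 2) := by gcongr; exacts [hL n, hJle n]
  have hforce : 2 * ((u n).re * (g n).im - (u n).im * (g n).re)
      ≤ δ * ‖u n‖ ^ 2 + ‖g n‖ ^ 2 / δ := by
    rw [Complex.sq_norm, Complex.sq_norm, Complex.normSq_apply, Complex.normSq_apply]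
    have h1 : δ * ((u n).re * (u n).re + (u n).im * (u n).im)
        + ((g n).re * (g n).re + (g n).im * (g n).im) / δ
        - 2 * ((u n).re * (g n).im - (u n).im * (g n).re)
        = ((δ * (u n).re - (g n).im) ^ 2 + (δ * (u n).im + (g n).re) ^ 2) / δ := by
      field_simp
      ring
    have h2 : 0 ≤ ((δ * (u n).re - (g n).im) ^ 2 + (δ * (u n).im + (g n).re) ^ 2) / δ := by
      positivity
    linarith
  have hforceθ := mul_le_mul_of_nonneg_left hforce (hθ n).1
  have hsq : ‖u n‖ ^ 2 = (u n).re * (u n).re + (u n).im * (u n).im := by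
    rw [Complex.sq_norm, Complex.normSq_apply]
  have hre : (u n).re * (latticeField hσ δ g u n).re + (u n).im * (latticeField hσ δ g u n).im
      = J (n - 1) - J n + ((u n).re * (g n).im - (u n).im * (g n).re) - δ * ‖u n‖ ^ 2 := by
    rw [latticeField_apply, hsq]
    simp only [hJ, sub_add_cancel, Complex.sub_re, Complex.sub_im, Complex.add_re, Complex.add_im,
      Complex.mul_re, Complex.mul_im, Complex.I_re, Complex.I_im, Complex.ofReal_re,
      Complex.ofReal_im, Complex.re_ofNat, Complex.im_ofNat]
    ring
  have ha1 : a (n - 1) - a n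
      = 2 * θ n * (J (n - 1) - J n) - 2 * (θ (n + 1) - θ n) * J n := by
    simp only [ha, sub_add_cancel]; ring
  rw [hre, ha1]
  have e : θ n * (δ * ‖u n‖ ^ 2 + ‖g n‖ ^ 2 / δ)
    = δ * (θ n * ‖u n‖ ^ 2) + θ n * ‖g n‖ ^ 2 / δ := by ring
  nlinarith

theorem isDissipative_latticeField {σ δ : ℝ} (hσ : 0 ≤ σ) (hδ : 0 < δ) (g : Ell2) :
    IsDissipative (latticeField hσ δ g) δ (‖g‖ ^ 2 / δ) := by
  refine ⟨exists_lipschitzOnWith_latticeField hσ δ g, fun u => ?_⟩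
  have hone : ∀ n : ℤ, (fun _ => 1 : ℤ → ℝ) n ∈ Set.Icc (0 : ℝ) 1 := fun _ => by simp
  have hid : ∀ w : Ell2, weightMul hone w = w := fun w => by ext n; simp
  have hsq : ∀ x : Ell2, (inner ℂ x x).re = ‖x‖ ^ 2 := fun x => inner_self_eq_norm_sq (𝕜 := ℂ) x
  simpa only [hid, hsq, mul_zero, zero_mul, add_zero] using
    re_inner_weightMul_latticeField_le (L := 0) hσ hδ hone (fun _ => by simp) g u

end Weight

/-! ### Truncation -/

section Truncation

variable {m : ℕ}

theorem toEll2_apply_of_mem (ψ : Trunc m) {n : ℤ} (h : n ∈ Finset.Icc (-(m : ℤ)) m) :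
    toEll2 m ψ n = ψ ⟨n, h⟩ := dif_pos h

theorem toEll2_apply_of_notMem (ψ : Trunc m) {n : ℤ} (h : n ∉ Finset.Icc (-(m : ℤ)) m) :
    toEll2 m ψ n = 0 := dif_neg h

theorem norm_toEll2 (ψ : Trunc m) : ‖toEll2 m ψ‖ = ‖ψ‖ := by
  have h1 : HasSum (fun n => ‖toEll2 m ψ n‖ ^ 2)
      (∑ n ∈ Finset.Icc (-(m : ℤ)) m, ‖toEll2 m ψ n‖ ^ 2) :=
    hasSum_sum_of_ne_finset_zero fun n hn => by simp [toEll2_apply_of_notMem ψ hn]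
  have h2 : ‖toEll2 m ψ‖ ^ 2 = ‖ψ‖ ^ 2 := by
    rw [(toEll2 m ψ).hasSum_norm_sq.unique h1, EuclideanSpace.norm_sq_eq, ← Finset.sum_coe_sort]
    exact Finset.sum_congr rfl fun n _ => by rw [toEll2_apply_of_mem ψ n.2]
  exact (pow_left_inj₀ (norm_nonneg _) (norm_nonneg _) two_ne_zero).1 h2

/-- Extension by zero as a linear isometry. -/
def truncEmbed (m : ℕ) : Trunc m →ₗᵢ[ℂ] Ell2 where
  toFun := toEll2 m
  map_add' ψ χ := by
    ext n
    by_cases h : n ∈ Finset.Icc (-(m : ℤ)) m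
    · simp [toEll2_apply_of_mem _ h]
    · simp [toEll2_apply_of_notMem _ h]
  map_smul' c ψ := by
    ext n
    by_cases h : n ∈ Finset.Icc (-(m : ℤ)) m
    · simp [toEll2_apply_of_mem _ h]
    · simp [toEll2_apply_of_notMem _ h]
  norm_map' := norm_toEll2

theorem toEll2_sub (ψ χ : Trunc m) : toEll2 m (ψ - χ) = toEll2 m ψ - toEll2 m χ :=
  map_sub (truncEmbed m) ψ χ

/-- Restriction of a sequence to the sites `|n| ≤ m`. -/
def truncRestrict (m : ℕ) (u : Ell2) : Trunc m := WithLp.toLp 2 fun n => u n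

@[simp] theorem truncRestrict_apply (u : Ell2) (n : Finset.Icc (-(m : ℤ)) (m : ℤ)) :
    truncRestrict m u n = u n := rfl

theorem truncRestrict_sub (u v : Ell2) :
    truncRestrict m (u - v) = truncRestrict m u - truncRestrict m v := rfl

theorem toEll2_truncRestrict_apply_of_mem (u : Ell2) {n : ℤ}
    (h : n ∈ Finset.Icc (-(m : ℤ)) m) : toEll2 m (truncRestrict m u) n = u n := by
  rw [toEll2_apply_of_mem _ h, truncRestrict_apply]

theorem norm_truncRestrict_le (u : Ell2) : ‖truncRestrict m u‖ ≤ ‖u‖ := by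
  rw [← norm_toEll2]
  refine lp.norm_mono two_ne_zero fun n => ?_
  by_cases h : n ∈ Finset.Icc (-(m : ℤ)) m
  · rw [toEll2_truncRestrict_apply_of_mem u h]
  · rw [toEll2_apply_of_notMem _ h, norm_zero]
    exact norm_nonneg _

/-- Restriction is the adjoint of extension by zero, also in the presence of a weight. -/
theorem inner_weightMul_toEll2_truncRestrict {θ : ℤ → ℝ} (hθ : ∀ n, θ n ∈ Set.Icc (0 : ℝ) 1)
    (ψ : Trunc m) (w : Ell2) :
    inner ℂ (weightMul hθ (toEll2 m ψ)) (toEll2 m (truncRestrict m w))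
      = inner ℂ (weightMul hθ (toEll2 m ψ)) w := by
  rw [lp.inner_eq_tsum, lp.inner_eq_tsum]
  refine tsum_congr fun n => ?_
  by_cases h : n ∈ Finset.Icc (-(m : ℤ)) m
  · rw [toEll2_truncRestrict_apply_of_mem w h]
  · rw [weightMul_apply, toEll2_apply_of_notMem ψ h]
    simp

theorem inner_truncRestrict (ψ : Trunc m) (w : Ell2) :
    inner ℂ ψ (truncRestrict m w) = inner ℂ (toEll2 m ψ) w := by
  have hone : ∀ n : ℤ, (fun _ => 1 : ℤ → ℝ) n ∈ Set.Icc (0 : ℝ) 1 := fun _ => by simp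
  have hid : weightMul hone (toEll2 m ψ) = toEll2 m ψ := by ext n; simp
  have h := inner_weightMul_toEll2_truncRestrict hone ψ w
  rw [hid] at h
  rw [← h]
  exact ((truncEmbed m).inner_map_map ψ (truncRestrict m w)).symm

end Truncation

section TruncatedField

variable {σ δ : ℝ} {m : ℕ}

/-- The vector field of the truncated system. The Dirichlet conditions are built into the extension
by zero. -/
def truncatedField (hσ : 0 ≤ σ) (δ : ℝ) (g : Ell2) (m : ℕ) (ψ : Trunc m) : Trunc m :=
  truncRestrict m (latticeField hσ δ g (toEll2 m ψ))

theorem isDissipative_truncatedField (hσ : 0 ≤ σ) (hδ : 0 < δ) (g : Ell2) (m : ℕ) :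
    IsDissipative (truncatedField hσ δ g m) δ (‖g‖ ^ 2 / δ) := by
  have hf := isDissipative_latticeField hσ hδ g
  refine ⟨fun R => ?_, fun ψ => ?_⟩
  · obtain ⟨K, hK⟩ := hf.lipschitz R
    refine ⟨K, LipschitzOnWith.of_dist_le_mul fun ψ hψ χ hχ => ?_⟩
    rw [mem_closedBall_zero_iff] at hψ hχ
    have h := hK.dist_le_mul (toEll2 m ψ) (by rwa [mem_closedBall_zero_iff, norm_toEll2])
      (toEll2 m χ) (by rwa [mem_closedBall_zero_iff, norm_toEll2])
    rw [dist_eq_norm, dist_eq_norm, ← toEll2_sub, norm_toEll2] at h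
    rw [dist_eq_norm, dist_eq_norm, truncatedField, truncatedField, ← truncRestrict_sub]
    exact (norm_truncRestrict_le _).trans h
  · have h := hf.inner_le (toEll2 m ψ)
    rwa [← inner_truncRestrict, norm_toEll2] at h

theorem isLatticeSolution_iff (hσ : 0 ≤ σ) (hδ : 0 < δ) (g : Ell2) (u : ℝ → Ell2) :
    IsLatticeSolution σ δ g u ↔ SolvesForward (latticeField hσ δ g) u := by
  constructor
  · rintro ⟨v, -, hv⟩ t ht
    have h : v t = latticeField hσ δ g (u t) := by
      ext n
      exact (equation_iff hσ g (u t) _ n).1 ((hv t ht).2 n)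
    exact h ▸ (hv t ht).1
  · intro hu
    refine ⟨fun t => latticeField hσ δ g (u t), ?_, fun t ht => ⟨hu t ht, fun n => ?_⟩⟩
    · exact (isDissipative_latticeField hσ hδ g).continuous.comp_continuousOn
        fun t ht => (hu t ht).continuousWithinAt
    · exact (equation_iff hσ g (u t) _ n).2 rfl

theorem isTruncatedSolution_iff (hσ : 0 ≤ σ) (hδ : 0 < δ) (g : Ell2) (ψ : ℝ → Trunc m) :
    IsTruncatedSolution σ δ g m ψ ↔ SolvesForward (truncatedField hσ δ g m) ψ := by
  constructor
  · rintro ⟨v, -, hv⟩ t ht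
    have h : v t = truncatedField hσ δ g m (ψ t) := by
      ext n
      exact (equation_iff hσ g (toEll2 m (ψ t)) _ n).1 ((hv t ht).2 n)
    exact h ▸ (hv t ht).1
  · intro hψ
    refine ⟨fun t => truncatedField hσ δ g m (ψ t), ?_, fun t ht => ⟨hψ t ht, fun n => ?_⟩⟩
    · exact (isDissipative_truncatedField hσ hδ g m).continuous.comp_continuousOn
        fun t ht => (hψ t ht).continuousWithinAt
    · exact (equation_iff hσ g (toEll2 m (ψ t)) _ n).2 rfl

theorem hasDerivWithinAt_toEll2 {ψ : ℝ → Trunc m} {v : Trunc m} {s : Set ℝ} {t : ℝ}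
    (h : HasDerivWithinAt ψ v s t) :
    HasDerivWithinAt (fun t => toEll2 m (ψ t)) (toEll2 m v) s t :=
  ((truncEmbed m).toContinuousLinearMap.restrictScalars ℝ).hasFDerivAt.comp_hasDerivWithinAt t h

end TruncatedField

/-! ### Uniform smallness of the tails -/

section Tail

/-- A piecewise linear weight that vanishes for `|n| ≤ k + 1`, equals `1` for `|n| ≥ 2 (k + 1)`, and
varies by at most `1 / (k + 1)` from site to site. -/
def tailWeight (k : ℕ) (n : ℤ) : ℝ := max 0 (min 1 (|(n : ℝ)| / (k + 1) - 1))

theorem tailWeight_mem (k : ℕ) (n : ℤ) : tailWeight k n ∈ Set.Icc (0 : ℝ) 1 :=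
  ⟨le_max_left _ _, max_le zero_le_one (min_le_left _ _)⟩

theorem tailWeight_eq_one {k : ℕ} {n : ℤ} (hn : 2 * ((k : ℝ) + 1) ≤ |(n : ℝ)|) :
    tailWeight k n = 1 := by
  have h : 2 ≤ |(n : ℝ)| / (k + 1) := (le_div_iff₀ (by positivity)).2 hn
  rw [tailWeight, min_eq_left (by linarith), max_eq_right zero_le_one]

theorem tailWeight_eq_zero {k : ℕ} {n : ℤ} (hn : |(n : ℝ)| ≤ k + 1) : tailWeight k n = 0 := by
  have h : |(n : ℝ)| / (k + 1) ≤ 1 := (div_le_one (by positivity)).2 hn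
  rw [tailWeight, max_eq_left]
  exact (min_le_right _ _).trans (by linarith)

theorem abs_tailWeight_sub_le (k : ℕ) (n : ℤ) :
    |tailWeight k (n + 1) - tailWeight k n| ≤ 1 / ((k : ℝ) + 1) := by
  rw [tailWeight, tailWeight, max_comm 0, max_comm 0, min_comm 1, min_comm 1]
  refine (abs_max_sub_max_le_abs _ _ _).trans ?_
  refine (abs_min_sub_min_le_max _ _ _ _).trans ?_
  rw [sub_self, abs_zero, max_eq_left (abs_nonneg _)]
  have h : |((n + 1 : ℤ) : ℝ)| / ((k : ℝ) + 1) - 1 - (|(n : ℝ)| / ((k : ℝ) + 1) - 1)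
      = (|((n + 1 : ℤ) : ℝ)| - |(n : ℝ)|) / (k + 1) := by ring
  rw [h, abs_div, abs_of_pos (by positivity : (0 : ℝ) < k + 1)]
  gcongr
  refine (abs_abs_sub_abs_le _ _).trans ?_
  simp

/-- The energy `∑ θ n |u n|²` carried by the far sites. -/
def tailEnergy (k : ℕ) (u : Ell2) : ℝ := (inner ℂ (weightMul (tailWeight_mem k) u) u).re

theorem tailEnergy_nonneg (k : ℕ) (u : Ell2) : 0 ≤ tailEnergy k u :=
  re_inner_weightMul_self_nonneg _ u

theorem tendsto_tailEnergy (u : Ell2) : Tendsto (fun k => tailEnergy k u) atTop (𝓝 0) := by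
  have h : Tendsto (fun k => ∑' n, tailWeight k n * ‖u n‖ ^ 2) atTop (𝓝 (∑' _ : ℤ, (0 : ℝ))) := by
    refine tendsto_tsum_of_dominated_convergence u.hasSum_norm_sq.summable (fun n => ?_)
      (Eventually.of_forall fun k n => ?_)
    · refine tendsto_const_nhds.congr' ?_
      obtain ⟨N, hN⟩ := exists_nat_ge |(n : ℝ)|
      filter_upwards [eventually_ge_atTop N] with k hk
      have hk' : (N : ℝ) ≤ k := Nat.cast_le.2 hk
      rw [tailWeight_eq_zero (by linarith), zero_mul]
    · rw [Real.norm_of_nonneg (mul_nonneg (tailWeight_mem k n).1 (sq_nonneg _))]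
      exact mul_le_of_le_one_left (sq_nonneg _) (tailWeight_mem k n).2
  rw [tsum_zero] at h
  exact h.congr fun k => (hasSum_re_inner_weightMul_self (tailWeight_mem k) u).tsum_eq

theorem norm_sub_toEll2_truncRestrict_sq_le {k m : ℕ} (h : 2 * (k + 1) ≤ m) (u : Ell2) :
    ‖u - toEll2 m (truncRestrict m u)‖ ^ 2 ≤ tailEnergy k u := by
  refine hasSum_le (fun n => ?_) (Ell2.hasSum_norm_sq _)
    (hasSum_re_inner_weightMul_self (tailWeight_mem k) u)
  rw [lp.coeFn_sub, Pi.sub_apply]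
  by_cases hn : n ∈ Finset.Icc (-(m : ℤ)) m
  · rw [toEll2_truncRestrict_apply_of_mem u hn, sub_self, norm_zero, zero_pow two_ne_zero]
    exact mul_nonneg (tailWeight_mem k n).1 (sq_nonneg _)
  · rw [toEll2_apply_of_notMem _ hn, sub_zero, tailWeight_eq_one, one_mul]
    rw [Finset.mem_Icc, ← abs_le, not_le] at hn
    rw [← Int.cast_abs]
    exact_mod_cast (by omega : (2 * (k + 1) : ℤ) ≤ |n|)

/-- The asymptotic bound on the energy of the tails of solutions in the ball of radius `R`. -/
def tailBound (δ R : ℝ) (g : Ell2) (k : ℕ) : ℝ :=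
  (tailEnergy k g / δ + 2 * (1 / ((k : ℝ) + 1)) * R ^ 2) / δ

theorem tendsto_tailBound (δ R : ℝ) (g : Ell2) :
    Tendsto (tailBound δ R g) atTop (𝓝 0) := by
  have h := ((((tendsto_tailEnergy g).div_const δ).add
    (((tendsto_one_div_add_atTop_nhds_zero_nat (𝕜 := ℝ)).const_mul 2).mul_const
      (R ^ 2))).div_const δ)
  simp only [zero_div, mul_zero, zero_mul, add_zero] at h
  exact h

variable {σ δ : ℝ}

/-- The tail estimate. The velocity `v` only has to agree with the lattice field when tested against
`θ u`, which is true of the solutions of the truncated systems as well. -/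
theorem tailEnergy_le (hσ : 0 ≤ σ) (hδ : 0 < δ) (g : Ell2) (k : ℕ) {R T : ℝ} (hT : 0 ≤ T)
    {u v : ℝ → Ell2} (hu : ∀ t ∈ Set.Icc 0 T, HasDerivWithinAt u (v t) (Set.Icc 0 T) t)
    (hv : ∀ t, inner ℂ (weightMul (tailWeight_mem k) (u t)) (v t)
      = inner ℂ (weightMul (tailWeight_mem k) (u t)) (latticeField hσ δ g (u t)))
    (hR : ∀ t ∈ Set.Icc 0 T, ‖u t‖ ≤ R) :
    tailEnergy k (u T) ≤ Real.exp (-δ * T) * R ^ 2 + tailBound δ R g k := by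
  have hk : (0 : ℝ) ≤ 1 / ((k : ℝ) + 1) := by positivity
  have hg := tailEnergy_nonneg k g
  have h := quadraticForm_le_of_inner_le (weightMul (tailWeight_mem k))
    (inner_weightMul_comm (tailWeight_mem k)) (δ := δ)
    (C := tailEnergy k g / δ + 2 * (1 / ((k : ℝ) + 1)) * R ^ 2) hδ (by positivity) hT hu
    (fun t ht => by
      rw [hv]
      refine (re_inner_weightMul_latticeField_le hσ hδ (tailWeight_mem k)
        (abs_tailWeight_sub_le k) g (u t)).trans ?_
      have := hR t ht
      rw [tailEnergy]
      gcongr)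
  refine h.trans ?_
  rw [tailBound]
  gcongr
  refine (re_inner_weightMul_self_le _ _).trans ?_
  have := hR 0 ⟨le_rfl, hT⟩
  gcongr

theorem tailEnergy_le_of_solvesOn (hσ : 0 ≤ σ) (hδ : 0 < δ) (g : Ell2) (k : ℕ) {R T : ℝ}
    (hT : 0 ≤ T) {u : ℝ → Ell2} (hu : SolvesOn (latticeField hσ δ g) T u)
    (hR : ∀ t ∈ Set.Icc 0 T, ‖u t‖ ≤ R) :
    tailEnergy k (u T) ≤ Real.exp (-δ * T) * R ^ 2 + tailBound δ R g k :=
  tailEnergy_le hσ hδ g k hT hu (fun _ => rfl) hR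

theorem tailEnergy_toEll2_le_of_solvesOn (hσ : 0 ≤ σ) (hδ : 0 < δ) (g : Ell2) (k : ℕ) {m : ℕ}
    {R T : ℝ} (hT : 0 ≤ T) {ψ : ℝ → Trunc m} (hψ : SolvesOn (truncatedField hσ δ g m) T ψ)
    (hR : ∀ t ∈ Set.Icc 0 T, ‖ψ t‖ ≤ R) :
    tailEnergy k (toEll2 m (ψ T)) ≤ Real.exp (-δ * T) * R ^ 2 + tailBound δ R g k :=
  tailEnergy_le hσ hδ g k (u := fun t => toEll2 m (ψ t)) hT
    (fun t ht => hasDerivWithinAt_toEll2 (hψ t ht))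
    (fun _ => inner_weightMul_toEll2_truncRestrict _ _ _)
    (fun t ht => (norm_toEll2 _).trans_le (hR t ht))

end Tail

/-! ### Global attractors and their upper semicontinuity -/

section Attractors

variable {σ δ : ℝ}

theorem exists_isGlobalAttractor_lattice (hσ : 0 ≤ σ) (hδ : 0 < δ) (g : Ell2)
    {S : ℝ≥0 → Ell2 → Ell2} (hS : IsSolutionSemigroup (SolvesForward (latticeField hσ δ g)) S) :
    ∃ A, IsGlobalAttractor S A := by
  have hf := isDissipative_latticeField hσ hδ g
  set R₀ := trappingRadius δ (‖g‖ ^ 2 / δ) 0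
  set R₁ := trappingRadius δ (‖g‖ ^ 2 / δ) R₀
  refine ⟨_, isGlobalAttractor_omegaLimitSet hS.add_apply (hf.continuous_semigroup hδ hS)
    (B := Metric.closedBall 0 R₀) (fun D hD => hf.exists_absorbing hδ hS hD) fun ε hε => ?_⟩
  have hε2 : 0 < ε ^ 2 / 2 := by positivity
  obtain ⟨k, hk⟩ := ((tendsto_tailBound δ R₁ g).eventually_lt_const hε2).exists
  obtain ⟨T, hT⟩ := eventually_atTop.1
    ((tendsto_exp_neg_mul_mul_atTop hδ (R₁ ^ 2)).eventually_lt_const hε2)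
  refine ⟨toEll2 (2 * (k + 1)) '' Metric.closedBall 0 R₁,
    (isCompact_closedBall _ _).image (truncEmbed _).continuous, T, fun t ht x hx => ?_⟩
  have hsol := (hS.solves x).solvesOn t
  have hx0 : ‖S (0 : ℝ).toNNReal x‖ ≤ R₀ := by
    rw [Real.toNNReal_zero, hS.initial]
    exact mem_closedBall_zero_iff.1 hx
  have hR : ∀ s ∈ Set.Icc (0 : ℝ) t, ‖S s.toNNReal x‖ ≤ R₁ :=
    fun s hs => hf.norm_le_trappingRadius hδ hsol hx0 hs
  have htail := tailEnergy_le_of_solvesOn hσ hδ g k t.coe_nonneg hsol hR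
  have hRt := hR t ⟨t.2, le_rfl⟩
  rw [Real.toNNReal_coe] at htail hRt
  refine ⟨_, ⟨truncRestrict _ (S t x), mem_closedBall_zero_iff.2
    ((norm_truncRestrict_le _).trans hRt), rfl⟩, ?_⟩
  rw [dist_eq_norm]
  refine lt_of_pow_lt_pow_left₀ 2 hε.le ?_
  have h1 := norm_sub_toEll2_truncRestrict_sq_le (le_refl (2 * (k + 1))) (S t x)
  have h2 := hT t ht
  linarith

theorem exists_isGlobalAttractor_truncated (hσ : 0 ≤ σ) (hδ : 0 < δ) (g : Ell2) (m : ℕ)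
    {S : ℝ≥0 → Trunc m → Trunc m}
    (hS : IsSolutionSemigroup (SolvesForward (truncatedField hσ δ g m)) S) :
    ∃ A, IsGlobalAttractor S A := by
  have hf := isDissipative_truncatedField hσ hδ g m
  refine ⟨_, isGlobalAttractor_omegaLimitSet hS.add_apply (hf.continuous_semigroup hδ hS)
    (fun D hD => hf.exists_absorbing hδ hS hD) fun ε hε => ?_⟩
  obtain ⟨T, hT⟩ := hf.exists_absorbing hδ hS Metric.isBounded_closedBall
  exact ⟨_, isCompact_closedBall _ _, T, fun t ht x hx => ⟨_, hT t ht x hx, by simpa using hε⟩⟩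

/-- Outside `|n| ≤ m` the field of a state supported in `|n| ≤ m` only sees the values of the state
at the boundary sites `± m` and the driving term. -/
theorem norm_latticeField_sub_truncatedField_le (hσ : 0 ≤ σ) (g : Ell2) {k m : ℕ}
    (h : 2 * (k + 1) < m) (ψ : Trunc m) :
    ‖latticeField hσ δ g (toEll2 m ψ) - toEll2 m (truncatedField hσ δ g m ψ)‖
      ≤ 2 * √(tailEnergy k (toEll2 m ψ)) + √(tailEnergy k g) := by
  have hQ : ∀ w : Ell2, ‖w - toEll2 (2 * (k + 1)) (truncRestrict _ w)‖ ≤ √(tailEnergy k w) :=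
    fun w => Real.le_sqrt_of_sq_le (norm_sub_toEll2_truncRestrict_sq_le le_rfl w)
  set w := toEll2 m ψ with hw
  set Q : Ell2 → Ell2 := fun w => w - toEll2 (2 * (k + 1)) (truncRestrict _ w) with hQdef
  have hQout : ∀ (w : Ell2) (n : ℤ), (m : ℤ) ≤ |n| → Q w n = w n := by
    intro w n hn
    have : n ∉ Finset.Icc (-((2 * (k + 1) : ℕ) : ℤ)) ((2 * (k + 1) : ℕ) : ℤ) := by
      rw [Finset.mem_Icc, ← abs_le]
      push_cast
      omega
    rw [hQdef, lp.coeFn_sub, Pi.sub_apply, toEll2_apply_of_notMem _ this, sub_zero]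
  have hle : ‖latticeField hσ δ g w - toEll2 m (truncatedField hσ δ g m ψ)‖
      ≤ ‖shift 1 (Q w) + shift (-1) (Q w) - Q g‖ := by
    refine lp.norm_mono two_ne_zero fun n => ?_
    rw [lp.coeFn_sub, Pi.sub_apply]
    by_cases hn : n ∈ Finset.Icc (-(m : ℤ)) m
    · rw [truncatedField, toEll2_truncRestrict_apply_of_mem _ hn, sub_self, norm_zero]
      exact norm_nonneg _
    · have hwn : w n = 0 := toEll2_apply_of_notMem ψ hn
      rw [Finset.mem_Icc, ← abs_le, not_le] at hn
      have h1 : (m : ℤ) ≤ |n + 1| := by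
        rcases lt_abs.1 hn with h | h
        · exact le_abs.2 (Or.inl (by omega))
        · exact le_abs.2 (Or.inr (by omega))
      have h2 : (m : ℤ) ≤ |n + -1| := by
        rcases lt_abs.1 hn with h | h
        · exact le_abs.2 (Or.inl (by omega))
        · exact le_abs.2 (Or.inr (by omega))
      rw [toEll2_apply_of_notMem _ (by rwa [Finset.mem_Icc, ← abs_le, not_le]), sub_zero,
        latticeField_apply, hwn, lp.coeFn_sub, lp.coeFn_add, Pi.sub_apply, Pi.add_apply,
        shift_apply, shift_apply, hQout w _ h1, hQout w _ h2, hQout g n hn.le]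
      simp [sub_eq_add_neg]
  refine hle.trans ((norm_sub_le _ _).trans ?_)
  have h1 := norm_add_le (shift 1 (Q w)) (shift (-1) (Q w))
  rw [norm_shift, norm_shift] at h1
  have h2 := hQ w
  have h3 := hQ g
  simp only [hQdef] at h1 ⊢
  linarith

theorem IsGlobalAttractor.subset_closedBall {m : ℕ} (hσ : 0 ≤ σ) (hδ : 0 < δ) {g : Ell2}
    {S : ℝ≥0 → Trunc m → Trunc m}
    (hS : IsSolutionSemigroup (SolvesForward (truncatedField hσ δ g m)) S) {A : Set (Trunc m)}
    (hA : IsGlobalAttractor S A) :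
    A ⊆ Metric.closedBall 0 (trappingRadius δ (‖g‖ ^ 2 / δ) 0) :=
  hA.subset_of_absorbing
    ((isDissipative_truncatedField hσ hδ g m).exists_absorbing hδ hS hA.isCompact.isBounded)

/-- Points of the attractor have an infinite past inside the attractor, so the transient term of the
tail estimate disappears, and what remains does not depend on `m`. -/
theorem IsGlobalAttractor.tailEnergy_toEll2_le {m : ℕ} (hσ : 0 ≤ σ) (hδ : 0 < δ) {g : Ell2}
    {S : ℝ≥0 → Trunc m → Trunc m}
    (hS : IsSolutionSemigroup (SolvesForward (truncatedField hσ δ g m)) S) {A : Set (Trunc m)}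
    (hA : IsGlobalAttractor S A) (k : ℕ) {x : Trunc m} (hx : x ∈ A) :
    tailEnergy k (toEll2 m x) ≤ tailBound δ (trappingRadius δ (‖g‖ ^ 2 / δ) 0) g k := by
  set R₀ := trappingRadius δ (‖g‖ ^ 2 / δ) 0
  have hlim := (tendsto_exp_neg_mul_mul_atTop hδ (R₀ ^ 2)).add_const (tailBound δ R₀ g k)
  rw [zero_add] at hlim
  refine ge_of_tendsto' hlim fun t => ?_
  rw [← hA.invariant t] at hx
  obtain ⟨y, hy, rfl⟩ := hx
  have h := tailEnergy_toEll2_le_of_solvesOn hσ hδ g k t.coe_nonneg ((hS.solves y).solvesOn t)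
    (R := R₀) (fun s _ => by
      refine mem_closedBall_zero_iff.1 (hA.subset_closedBall hσ hδ hS ?_)
      exact (hA.invariant s.toNNReal).subset ⟨y, hy, rfl⟩)
  rwa [Real.toNNReal_coe] at h

theorem tendsto_semidist_attractors (hσ : 0 ≤ σ) (hδ : 0 < δ) (g : Ell2)
    {S : ℝ≥0 → Ell2 → Ell2} {Sm : ∀ m : ℕ, ℝ≥0 → Trunc m → Trunc m}
    (hS : IsSolutionSemigroup (SolvesForward (latticeField hσ δ g)) S)
    (hSm : ∀ m, IsSolutionSemigroup (SolvesForward (truncatedField hσ δ g m)) (Sm m))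
    {A : Set Ell2} {Am : ∀ m : ℕ, Set (Trunc m)} (hA : IsGlobalAttractor S A)
    (hAm : ∀ m, IsGlobalAttractor (Sm m) (Am m)) :
    Tendsto (fun m : ℕ => semidist (toEll2 m '' Am m) A) atTop (𝓝 0) := by
  have hf := isDissipative_latticeField hσ hδ g
  set R₀ := trappingRadius δ (‖g‖ ^ 2 / δ) 0
  set R₁ := trappingRadius δ (‖g‖ ^ 2 / δ) R₀
  have hR₀₁ : R₀ ≤ R₁ := le_trappingRadius hδ hf.nonneg R₀
  obtain ⟨K, hK⟩ := hf.lipschitz R₁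
  refine ENNReal.tendsto_nhds_zero.2 fun ε hε => ?_
  obtain ⟨r, hr0, hrε⟩ : ∃ r : ℝ, 0 < r ∧ ENNReal.ofReal r + ENNReal.ofReal r ≤ ε := by
    obtain ⟨q, hq0, hqε⟩ := ENNReal.lt_iff_exists_nnreal_btwn.1 hε
    have hq0' : (0 : ℝ) < q := by exact_mod_cast hq0
    refine ⟨q / 2, by positivity, ?_⟩
    rw [← ENNReal.ofReal_add (by positivity) (by positivity), add_halves, ENNReal.ofReal_coe_nnreal]
    exact hqε.le
  -- A time after which the lattice flow has moved the ball of radius `R₀` close to `A`.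
  obtain ⟨T, hT⟩ := (ENNReal.tendsto_nhds_zero.1 (hA.attracts (Metric.closedBall 0 R₀)
    Metric.isBounded_closedBall) _ (ENNReal.ofReal_pos.2 hr0)).exists
  -- Up to that time, defects of size `2 √(tailBound) + √(tailEnergy g)` are harmless.
  have hdefect : Tendsto (fun k => gronwallBound 0 K
      (2 * √(tailBound δ R₀ g k) + √(tailEnergy k g) + 0) T) atTop (𝓝 0) := by
    have h1 : Tendsto (fun k => 2 * √(tailBound δ R₀ g k) + √(tailEnergy k g) + 0) atTop
        (𝓝 0) := by
      simpa using (((tendsto_tailBound δ R₀ g).sqrt.const_mul 2).add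
        (tendsto_tailEnergy g).sqrt).add_const 0
    have h2 := (gronwallBound_continuous_ε 0 K T).tendsto 0
    rw [gronwallBound_ε0_δ0] at h2
    exact h2.comp h1
  obtain ⟨k, hk⟩ := (hdefect.eventually_le_const hr0).exists
  filter_upwards [eventually_gt_atTop (2 * (k + 1))] with m hm
  refine semidist_le_iff.2 ?_
  rintro _ ⟨x, hx, rfl⟩
  rw [← (hAm m).invariant T] at hx
  obtain ⟨y, hy, rfl⟩ := hx
  have hmem : ∀ s, Sm m s y ∈ Am m := fun s => ((hAm m).invariant s).subset ⟨y, hy, rfl⟩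
  have hball : ∀ s, ‖toEll2 m (Sm m s y)‖ ≤ R₀ := fun s => by
    rw [norm_toEll2]
    exact mem_closedBall_zero_iff.1 ((hAm m).subset_closedBall hσ hδ (hSm m) (hmem s))
  have hy0 : ‖toEll2 m y‖ ≤ R₀ := by
    simpa [(hSm m).initial] using hball 0
  have hsol := (hS.solves (toEll2 m y)).solvesOn T
  have hsolm : ∀ t ∈ Set.Icc (0 : ℝ) T, HasDerivWithinAt (fun t : ℝ => toEll2 m (Sm m t.toNNReal y))
      (toEll2 m (truncatedField hσ δ g m (Sm m t.toNNReal y))) (Set.Icc 0 T) t :=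
    fun t ht => hasDerivWithinAt_toEll2 (((hSm m).solves y).solvesOn T t ht)
  have hsol0 : ‖S (0 : ℝ).toNNReal (toEll2 m y)‖ ≤ R₀ := by
    rwa [Real.toNNReal_zero, hS.initial]
  have hclose := dist_le_of_approx_trajectories_ODE_of_mem (v := fun _ => latticeField hσ δ g)
    (K := K) (s := fun _ => Metric.closedBall 0 R₁) (δ := 0) (fun _ _ => hK)
    (fun t ht => (hsolm t ht).continuousWithinAt)
    (fun t ht => hasDerivWithinAt_Ici_of_Icc (hsolm t (Set.Ico_subset_Icc_self ht)) ht)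
    (εf := 2 * √(tailBound δ R₀ g k) + √(tailEnergy k g)) (fun t _ => by
      rw [dist_comm, dist_eq_norm]
      refine (norm_latticeField_sub_truncatedField_le hσ g hm _).trans ?_
      gcongr
      exact (hAm m).tailEnergy_toEll2_le hσ hδ (hSm m) k (hmem _))
    (fun t _ => mem_closedBall_zero_iff.2 ((hball _).trans hR₀₁)) hsol.continuousOn
    (fun t ht => hasDerivWithinAt_Ici_of_Icc (hsol t (Set.Ico_subset_Icc_self ht)) ht)
    (εg := 0) (fun t _ => by rw [dist_self])
    (fun t ht => mem_closedBall_zero_iff.2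
      (hf.norm_le_trappingRadius hδ hsol hsol0 (Set.Ico_subset_Icc_self ht)))
    (by simp [hS.initial, (hSm m).initial]) T ⟨T.2, le_rfl⟩
  rw [Real.toNNReal_coe, sub_zero] at hclose
  have h1 : Metric.infEDist (S T (toEll2 m y)) A ≤ ENNReal.ofReal r :=
    semidist_le_iff.1 hT _ ⟨_, mem_closedBall_zero_iff.2 hy0, rfl⟩
  have h2 : edist (toEll2 m (Sm m T y)) (S T (toEll2 m y)) ≤ ENNReal.ofReal r := by
    rw [edist_dist]
    exact ENNReal.ofReal_le_ofReal (hclose.trans hk)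
  exact (Metric.infEDist_le_edist_add_infEDist).trans ((add_le_add h2 h1).trans hrε)

end Attractors

end DNLS

end

theorem theorem6p1 (σ δ : ℝ) (hσ : 0 ≤ σ) (hδ : 0 < δ) (g : DNLS.Ell2) :
    ∃ (S : ℝ≥0 → DNLS.Ell2 → DNLS.Ell2)
      (Sm : ∀ m : ℕ, ℝ≥0 → DNLS.Trunc m → DNLS.Trunc m),
      DNLS.IsSolutionSemigroup (DNLS.IsLatticeSolution σ δ g) S ∧
      (∀ m, DNLS.IsSolutionSemigroup (DNLS.IsTruncatedSolution σ δ g m) (Sm m)) ∧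
      (∃! A : Set DNLS.Ell2, DNLS.IsGlobalAttractor S A) ∧
      (∀ m, ∃! A : Set (DNLS.Trunc m), DNLS.IsGlobalAttractor (Sm m) A) ∧
      ∀ (A : Set DNLS.Ell2) (Am : ∀ m : ℕ, Set (DNLS.Trunc m)),
        DNLS.IsGlobalAttractor S A → (∀ m, DNLS.IsGlobalAttractor (Sm m) (Am m)) →
        Tendsto (fun m : ℕ => DNLS.semidist (DNLS.toEll2 m '' Am m) A) atTop (𝓝 0) := by
  obtain ⟨S, hS⟩ := (DNLS.isDissipative_latticeField hσ hδ g).exists_isSolutionSemigroup hδ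
  choose Sm hSm using fun m =>
    (DNLS.isDissipative_truncatedField hσ hδ g m).exists_isSolutionSemigroup hδ
  have hlat : DNLS.IsLatticeSolution σ δ g = DNLS.SolvesForward (DNLS.latticeField hσ δ g) :=
    funext fun u => propext (DNLS.isLatticeSolution_iff hσ hδ g u)
  have htr : ∀ m, DNLS.IsTruncatedSolution σ δ g m
      = DNLS.SolvesForward (DNLS.truncatedField hσ δ g m) :=
    fun m => funext fun ψ => propext (DNLS.isTruncatedSolution_iff hσ hδ g ψ)
  refine ⟨S, Sm, hlat ▸ hS, fun m => htr m ▸ hSm m, ?_, fun m => ?_, fun A Am hA hAm =>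
    DNLS.tendsto_semidist_attractors hσ hδ g hS hSm hA hAm⟩
  · obtain ⟨A, hA⟩ := DNLS.exists_isGlobalAttractor_lattice hσ hδ g hS
    exact ⟨A, hA, fun A' hA' => hA'.unique hA⟩
  · obtain ⟨A, hA⟩ := DNLS.exists_isGlobalAttractor_truncated hσ hδ g m (hSm m)
    exact ⟨A, hA, fun A' hA' => hA'.unique hA⟩
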